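/- **Strict ω-categories.** Strict $\omega$-categories are small; a cell is identified with the identities on it, and $\partial_{i}c$, $\partial_{-i}c$ denote the $i$-dimensional target and source of a cell $c$ (with $0\neq -0$ as indices); $b\circ_i a$ is defined when $\partial_i a=\partial_{-i}b$. Joyal's category $\Theta$ is the smallest isomorphism-closed full subcategory of strict $\omega$-categories that contains the terminal one and is closed under suspension and under wedge sums (pushouts over the terminal $\omega$-category) gluing an object with no nonidentity cell out of it to an object with no nonidentity cell into it. A map $\theta\to A$ with $\theta\in\Theta$ is *nondegenerate* if it does not factor through a noninvertible split epimorphism $\theta\twoheadrightarrow\zeta$ with $\zeta\in\Theta$. $A$ is *$\Theta$-regular* if every nondegenerate map $\theta\to A$ with $\theta\in\Theta$ is monic. $A$ is *hypercancellative* if for all $i\in\mathbb N$ and cells $a,b,a',b'$ with $\partial_i a=\partial_i a'=\partial_{-i}b=\partial_{-i}b'$, the equality $b\circ_i a=b'\circ_i a'$ implies $a=a'$ and $b=b'$. **Hypergraphs and cells.** A *hypergraph* $P$ consists of sets $P_n$ ($n\in\mathbb N$) of $n$-atoms and, for each $x\in P_{n+1}$, finite sets $x^-,x^+\subseteq P_n$.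 For $S\subseteq P_{n+1}$ put $S^{\epsilon}=\bigcup_{s\in S}s^{\epsilon}$, $S^\mp=S^-\setminus S^+$, $S^\pm=S^+\setminus S^-$; $S$ *moves* $X$ to $Y$ (with $X,Y\subseteq P_n$) if $S^\mp=X\setminus Y$ and $S^\pm=Y\setminus X$. A set $S\subseteq P_n$ is *fork-free* if $n=0$ and $S$ is a singleton, or $n\ge1$ and $u^-\cap v^-=u^+\cap v^+=\emptyset$ for all $u\ne v$ in $S$. An *$n$-cell* of $P$ is a family $c=(c_{-0},c_0,\dots,c_{-n},c_n)$ of finite fork-free sets $c_{\pm i}\subseteq P_i$ with $c_{-n}=c_n$ such that, for $0\le i<n$, both $c_{i+1}$ and $c_{-(i+1)}$ move $c_{-i}$ to $c_i$. Set $\partial_{\epsilon i}c=(c_{-0},c_0,\dots,c_{-(i-1)},c_{i-1},c_{\epsilon i},c_{\epsilon i})$; the identity on an $n$-cell $c$ is obtained by appending $c_{\pm(n+1)}=\emptyset$; and if $\partial_i c=\partial_{-i}d$, then $d\circ_i c$ has parts $c_{\epsilon j}=d_{\epsilon j}$ for $j<i$, $d_i$ for $(j,\epsilon)=(i,+)$,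 $c_{-i}$ for $(j,\epsilon)=(i,-)$, and $c_{\epsilon j}\cup d_{\epsilon j}$ for $j>i$. **Torsion-free complexes.** For an $n$-atom $a$ let $\langle a\rangle$ be the family with $\langle a\rangle_{\pm n}=\{a\}$, $\langle a\rangle_{i-1}=(\langle a\rangle_i)^\pm$, $\langle a\rangle_{-(i-1)}=(\langle a\rangle_{-i})^\mp$ for $1\le i\le n$. For $n$-atoms write $x\triangleleft y$ if $n\geq 1$ and $x^+\cap y^-\ne\emptyset$; for $U\subseteq P_n$ let $\triangleleft_U$ be the transitive closure of the restriction of $\triangleleft$ to $U$; $V\subseteq U$ is a *segment* of $U$ if $x\triangleleft_U y\triangleleft_U z$ and $x,z\in V$ imply $y\in V$. $P$ is a *torsion-free complex* if: - (T0) $x^-$ and $x^+$ are nonempty for every atom $x$ of positive dimension; - (T1) for every $n$, the transitive closure of $\triangleleft$ on $P_n$ is irreflexive; - (T2) $\langle x\rangle$ is a cell for every atom $x$; - (T3) for every atom $x$, $k<\dim x$, $\epsilon\in\{-,+\}$ and $k$-cell $X$ with $\langle x\rangle_{\epsilon k}\subseteq X_k$, the set $\langle x\rangle_{\epsilon k}$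 is a segment of $X_k$; - (T4) there are no atoms $x,y$, $k<\min(\dim x,\dim y)$ and $k$-cell $Z$ such that $\langle x\rangle_{k}\subseteq Z_k$, $\langle y\rangle_{-k}\subseteq Z_k$, $\langle x\rangle_{k}\cap\langle y\rangle_{-k}=\emptyset$, and there are $u,u'\in\langle x\rangle_k$ and $v,v'\in\langle y\rangle_{-k}$ with $u\triangleleft_{Z_k}v$ and $v'\triangleleft_{Z_k}u'$. **Proposition.** Let $P$ be a torsion-free complex. Then composites of cells of $P$ are cells, so that the cells of $P$ form a strict $\omega$-category $FP$, and $FP$ is $\Theta$-regular and hypercancellative. -/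

import Mathlib

open CategoryTheory CategoryTheory.Limits

universe u

/-! Signs are Booleans throughout: `false` stands for `-` (source), `true` for `+` (target). -/

/-! ### Strict ω-categories -/

/-- A (small) strict ω-category in one-sorted form: one collection of cells of all dimensions, in
which a cell is identified with the identities on it.  `bd false i x` and `bd true i x` are the
`i`-dimensional source and target of `x`; the cells of dimension `≤ n` are those fixed by
`bd false n` (equivalently by `bd true n`); `comp i b a _` is the composite `b ∘_i a`, defined
exactly when the `i`-target of `a` is the `i`-source of `b`. -/
structure StrictOmegaCat where
  Cell : Type u
  bd : Bool → ℕ → Cell → Cell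
  comp : ∀ (i : ℕ) (b a : Cell), bd true i a = bd false i b → Cell
  bd_bd_of_lt : ∀ (ε δ : Bool) (i j : ℕ) (x : Cell), i < j → bd ε i (bd δ j x) = bd ε i x
  bd_bd_of_le : ∀ (ε δ : Bool) (i j : ℕ) (x : Cell), i ≤ j → bd ε j (bd δ i x) = bd δ i x
  exists_dim : ∀ x : Cell, ∃ n : ℕ, bd false n x = x
  bd_false_comp : ∀ (i : ℕ) (b a : Cell) (h : bd true i a = bd false i b),
    bd false i (comp i b a h) = bd false i a
  bd_true_comp : ∀ (i : ℕ) (b a : Cell) (h : bd true i a = bd false i b),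
    bd true i (comp i b a h) = bd true i b
  bd_comp_of_lt : ∀ (ε : Bool) (i j : ℕ) (b a : Cell) (h : bd true i a = bd false i b)
    (h' : bd true i (bd ε j a) = bd false i (bd ε j b)), i < j →
    bd ε j (comp i b a h) = comp i (bd ε j b) (bd ε j a) h'
  comp_id : ∀ (i : ℕ) (x : Cell) (h : bd true i (bd false i x) = bd false i x),
    comp i x (bd false i x) h = x
  id_comp : ∀ (i : ℕ) (x : Cell) (h : bd true i x = bd false i (bd true i x)),
    comp i (bd true i x) x h = x
  assoc : ∀ (i : ℕ) (c b a : Cell) (hab : bd true i a = bd false i b)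
    (hbc : bd true i b = bd false i c) (h : bd true i (comp i b a hab) = bd false i c)
    (h' : bd true i a = bd false i (comp i c b hbc)),
    comp i c (comp i b a hab) h = comp i (comp i c b hbc) a h'
  interchange : ∀ (i j : ℕ) (a b c d : Cell), i < j →
    ∀ (hab : bd true j a = bd false j b) (hcd : bd true j c = bd false j d)
      (hac : bd true i a = bd false i c) (hbd : bd true i b = bd false i d)
      (h : bd true i (comp j b a hab) = bd false i (comp j d c hcd))
      (h' : bd true j (comp i c a hac) = bd false j (comp i d b hbd)),
    comp i (comp j d c hcd) (comp j b a hab) h = comp j (comp i d b hbd) (comp i c a hac) h'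

namespace StrictOmegaCat

/-- A strict ω-functor. -/
@[ext]
structure Hom (A B : StrictOmegaCat.{u}) where
  toFun : A.Cell → B.Cell
  map_bd : ∀ (ε : Bool) (i : ℕ) (x : A.Cell), toFun (A.bd ε i x) = B.bd ε i (toFun x)
  map_comp : ∀ (i : ℕ) (b a : A.Cell) (h : A.bd true i a = A.bd false i b)
    (h' : B.bd true i (toFun a) = B.bd false i (toFun b)),
    toFun (A.comp i b a h) = B.comp i (toFun b) (toFun a) h'

/-- The category of (small) strict ω-categories and strict ω-functors. -/
instance : Category StrictOmegaCat.{u} where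
  Hom := Hom
  id A := ⟨fun x => x, fun _ _ _ => rfl, fun _ _ _ _ _ => rfl⟩
  comp {A B C} F G :=
    ⟨fun x => G.toFun (F.toFun x),
     fun ε i x => by rw [F.map_bd, G.map_bd],
     fun i b a h h' => by
      have h1 : B.bd true i (F.toFun a) = B.bd false i (F.toFun b) := by
        rw [← F.map_bd, ← F.map_bd, h]
      rw [F.map_comp i b a h h1, G.map_comp i _ _ h1 h']⟩

/-- The suspension `Σ A`: two objects `inl false`, `inl true`, with `Hom(false, true) = A`, only
identities as endomorphisms, and `Hom(true, false)` empty.  An `n`-cell of `A` becomes an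
`(n+1)`-cell of `Σ A`. -/
def susp (A : StrictOmegaCat.{u}) : StrictOmegaCat.{u} where
  Cell := Bool ⊕ A.Cell
  bd ε i x := match i, x with
    | _, .inl p => .inl p
    | 0, .inr _ => .inl ε
    | i + 1, .inr x => .inr (A.bd ε i x)
  comp i b a h := match i, b, a, h with
    | _, .inl p, .inl _, _ => .inl p
    -- a mixed pair is composable only for `i = 0`, one factor being an identity on an object
    | _, .inl _, .inr x, _ => .inr x
    | _, .inr x, .inl _, _ => .inr x
    -- this case does not occur
    | 0, .inr x, .inr _, _ => .inr x
    | i + 1, .inr b, .inr a, h => .inr (A.comp i b a (Sum.inr.inj h))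
  bd_bd_of_lt ε δ i j x hij := by
    rcases x with p | x <;> rcases i with _ | i <;> rcases j with _ | j <;> simp_all
    exact A.bd_bd_of_lt _ _ _ _ _ hij
  bd_bd_of_le ε δ i j x hij := by
    rcases x with p | x <;> rcases i with _ | i <;> rcases j with _ | j <;> simp_all
    exact A.bd_bd_of_le _ _ _ _ _ hij
  exists_dim x := by
    rcases x with p | x
    · exact ⟨0, rfl⟩
    · obtain ⟨n, hn⟩ := A.exists_dim x
      exact ⟨n + 1, congrArg Sum.inr hn⟩
  bd_false_comp i b a h := by
    rcases b with p | b <;> rcases a with q | a <;> rcases i with _ | i <;> simp_all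
    exact A.bd_false_comp _ _ _ _
  bd_true_comp i b a h := by
    rcases b with p | b <;> rcases a with q | a <;> rcases i with _ | i <;> simp_all
    exact A.bd_true_comp _ _ _ _
  bd_comp_of_lt ε i j b a h h' hij := by
    rcases b with p | b <;> rcases a with q | a <;> rcases i with _ | i <;>
      rcases j with _ | j <;> simp_all
    exact A.bd_comp_of_lt _ _ _ _ _ _ _ hij
  comp_id i x h := by
    rcases x with p | x <;> rcases i with _ | i
    · rfl
    · rfl
    · rfl
    · exact congrArg Sum.inr (A.comp_id i x (Sum.inr.inj h))
  id_comp i x h := by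
    rcases x with p | x <;> rcases i with _ | i
    · rfl
    · rfl
    · rfl
    · exact congrArg Sum.inr (A.id_comp i x (Sum.inr.inj h))
  assoc i c b a hab hbc h h' := by
    rcases c with r | c <;> rcases b with p | b <;> rcases a with q | a <;>
      rcases i with _ | i <;> simp_all
    exact A.assoc _ _ _ _ _ _ _ _
  interchange i j a b c d hij hab hcd hac hbd h h' := by
    rcases a with a | a <;> rcases b with b | b <;> rcases c with c | c <;>
      rcases d with d | d <;> rcases i with _ | i <;> rcases j with _ | j <;>
      first
      | exact absurd hij (by omega)
      | (exfalso; simp at hab; done)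
      | (exfalso; simp at hcd; done)
      | (exfalso; simp at hac; done)
      | (exfalso; simp at hbd; done)
      | exact congrArg Sum.inr (A.interchange i j a b c d (by omega) (Sum.inr.inj hab)
          (Sum.inr.inj hcd) (Sum.inr.inj hac) (Sum.inr.inj hbd) (Sum.inr.inj h) (Sum.inr.inj h'))
      | simp_all

/-- `a` is an object of `A` out of which there are no cells except the identities on `a`. -/
def IsSink (A : StrictOmegaCat.{u}) (a : A.Cell) : Prop :=
  A.bd false 0 a = a ∧ ∀ x : A.Cell, A.bd false 0 x = a → x = a

/-- `a` is an object of `A` into which there are no cells except the identities on `a`. -/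
def IsSource (A : StrictOmegaCat.{u}) (a : A.Cell) : Prop :=
  A.bd true 0 a = a ∧ ∀ x : A.Cell, A.bd true 0 x = a → x = a

/-- The objects of Joyal's category `Θ`, a full subcategory of strict ω-categories: the smallest
(isomorphism-closed) class containing the terminal ω-category and closed under suspensions and
under wedge sums (pushouts over the terminal ω-category `T`) gluing a sink to a source. -/
inductive IsTheta : StrictOmegaCat.{u} → Prop
  | point (T : StrictOmegaCat.{u}) (hT : Nonempty (IsTerminal T)) : IsTheta T
  | susp (A C : StrictOmegaCat.{u}) (hA : IsTheta A) (e : Nonempty (C ≅ A.susp)) : IsTheta C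
  | wedge (T A B C : StrictOmegaCat.{u}) (hT : Nonempty (IsTerminal T))
      (hA : IsTheta A) (hB : IsTheta B) (a : T ⟶ A) (b : T ⟶ B)
      (ha : ∀ t, A.IsSink (a.toFun t)) (hb : ∀ t, B.IsSource (b.toFun t))
      (inl : A ⟶ C) (inr : B ⟶ C) (hC : IsPushout a b inl inr) : IsTheta C

/-- A map `F : θ ⟶ A` with `θ ∈ Θ` is nondegenerate if it does not factor through any
noninvertible degeneracy (split epimorphism) `θ ↠ ζ` of `Θ`. -/
def IsNondegenerate {θ A : StrictOmegaCat.{u}} (F : θ ⟶ A) : Prop :=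
  ∀ (ζ : StrictOmegaCat.{u}) (p : θ ⟶ ζ) (G : ζ ⟶ A),
    ζ.IsTheta → IsSplitEpi p → p ≫ G = F → IsIso p

/-- `A` is `Θ`-regular: every nondegenerate map `θ ⟶ A` with `θ ∈ Θ` is monic. -/
def IsThetaRegular (A : StrictOmegaCat.{u}) : Prop :=
  ∀ (θ : StrictOmegaCat.{u}) (F : θ ⟶ A), θ.IsTheta → IsNondegenerate F → Mono F

/-- `A` is hypercancellative: if `b ∘_i a = b' ∘_i a'`, where the `i`-targets of `a`, `a'` and the
`i`-sources of `b`, `b'` are all the same, then `a = a'` and `b = b'`. -/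
def IsHypercancellative (A : StrictOmegaCat.{u}) : Prop :=
  ∀ (i : ℕ) (a b a' b' : A.Cell) (h : A.bd true i a = A.bd false i b)
    (h' : A.bd true i a' = A.bd false i b'), A.bd true i a = A.bd true i a' →
    A.comp i b a h = A.comp i b' a' h' → a = a' ∧ b = b'

end StrictOmegaCat

/-! ### Hypergraphs, cells and torsion-free complexes -/

/-- An (ω-)hypergraph: sets of `n`-atoms, and for each `(n+1)`-atom `x` two finite sets of
`n`-atoms `x⁻ = face false x` and `x⁺ = face true x`. -/
structure OmegaHypergraph where
  Atom : ℕ → Type u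
  face : Bool → ∀ {n : ℕ}, Atom (n + 1) → Finset (Atom n)

namespace OmegaHypergraph

variable (P : OmegaHypergraph.{u})

/-- `S⁻` and `S⁺`: the union of the sources, resp. targets, of the elements of `S`. -/
def faces (ε : Bool) {n : ℕ} (S : Set (P.Atom (n + 1))) : Set (P.Atom n) :=
  {z | ∃ s ∈ S, z ∈ P.face ε s}

/-- `S^∓ = S⁻ \ S⁺` (for `ε = false`) and `S^± = S⁺ \ S⁻` (for `ε = true`). -/
def border (ε : Bool) {n : ℕ} (S : Set (P.Atom (n + 1))) : Set (P.Atom n) :=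
  P.faces ε S \ P.faces (!ε) S

/-- `S` moves `X` to `Y`. -/
def Moves {n : ℕ} (S : Set (P.Atom (n + 1))) (X Y : Set (P.Atom n)) : Prop :=
  P.border false S = X \ Y ∧ P.border true S = Y \ X

/-- Fork-free sets of `n`-atoms. -/
def ForkFree : ∀ {n : ℕ}, Set (P.Atom n) → Prop
  | 0, S => ∃ x, S = {x}
  | _ + 1, S => ∀ u ∈ S, ∀ v ∈ S, u ≠ v → ∀ ε, Disjoint (P.face ε u) (P.face ε v)

/-- A pre-cell: sets `part false i`, `part true i` of `i`-atoms (written `c_{-i}`, `c_i` in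
mathematical notation), empty for all large `i`.  A pre-`n`-cell
`(c_{-0}, c_0, …, c_{-n} = c_n)` is extended by empty sets in dimensions `> n`; this identifies
it with its identities, and the pre-`n`-cells are those `c` with `bd false n c = c`. -/
@[ext]
structure PreCell where
  part : Bool → ∀ i : ℕ, Set (P.Atom i)
  bounded : ∃ n : ℕ, ∀ m, n ≤ m → ∀ ε, part ε m = ∅

variable {P}

/-- `∂_{ε i} c`: keep the parts in dimensions `< i`, put `c_{ε i}` on both sides in dimension
`i`, and nothing above. -/
def PreCell.bd (ε : Bool) (i : ℕ) (c : P.PreCell) : P.PreCell where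
  part δ j := if j < i then c.part δ j else if j = i then c.part ε j else ∅
  bounded := ⟨i + 1, fun m hm ε => by
    rw [if_neg (by omega), if_neg (by omega)]⟩

/-- The composite `d ∘_i c`. -/
def PreCell.comp (i : ℕ) (d c : P.PreCell) : P.PreCell where
  part δ j :=
    if j < i then c.part δ j
    else if j = i then (match δ with
      | true => d.part true j
      | false => c.part false j)
    else c.part δ j ∪ d.part δ j
  bounded := by
    obtain ⟨m, hm⟩ := c.bounded
    obtain ⟨n, hn⟩ := d.bounded
    refine ⟨m + n + i + 1, fun k hk ε => ?_⟩
    rw [if_neg (by omega), if_neg (by omega), hm k (by omega), hn k (by omega), Set.union_self]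

theorem PreCell.part_bd (ε δ : Bool) (i j : ℕ) (c : P.PreCell) :
    (c.bd ε i).part δ j = if j < i then c.part δ j else if j = i then c.part ε j else ∅ := rfl

theorem PreCell.part_comp (δ : Bool) (i j : ℕ) (d c : P.PreCell) :
    (PreCell.comp i d c).part δ j =
      if j < i then c.part δ j
      else if j = i then (match δ with
        | true => d.part true j
        | false => c.part false j)
      else c.part δ j ∪ d.part δ j := rfl

/-- Consequence of composability, part by part. -/
theorem PreCell.part_eq_of_bd_eq {i : ℕ} {c d : P.PreCell} (h : c.bd true i = d.bd false i) :
    (∀ δ j, j < i → c.part δ j = d.part δ j) ∧ c.part true i = d.part false i := by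
  constructor
  · intro δ j hj
    have := congrFun (congrFun (congrArg PreCell.part h) δ) j
    simpa [PreCell.part_bd, hj] using this
  · have := congrFun (congrFun (congrArg PreCell.part h) true) i
    simpa [PreCell.part_bd] using this

/-- A cell: a pre-cell with finite fork-free parts such that `c_{i+1}` and `c_{-(i+1)}` both move
`c_{-i}` to `c_i`.  (Above the dimension of `c` these conditions hold trivially.) -/
structure IsCell (c : P.PreCell) : Prop where
  finite : ∀ ε i, (c.part ε i).Finite
  forkFree : ∀ ε i, P.ForkFree (c.part ε i)
  moves : ∀ ε i, P.Moves (c.part ε (i + 1)) (c.part false i) (c.part true i)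

variable (P) in
/-- The family of sets generated downwards by `S ⊆ P_n`: it is `S` in dimension `n`, empty above,
and the part in dimension `i - 1` is the `ε`-border of the part in dimension `i`. -/
def down (ε : Bool) : ∀ n : ℕ, Set (P.Atom n) → ∀ i : ℕ, Set (P.Atom i)
  | 0, S => Function.update (fun _ => ∅) 0 S
  | n + 1, S => Function.update (down ε n (P.border ε S)) (n + 1) S

theorem down_eq_empty (ε : Bool) : ∀ (n : ℕ) (S : Set (P.Atom n)) (m : ℕ), n + 1 ≤ m →
    P.down ε n S m = ∅
  | 0, S, m, hm => by
    rw [down, Function.update_of_ne (by omega)]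
  | n + 1, S, m, hm => by
    rw [down, Function.update_of_ne (by omega)]
    exact down_eq_empty ε n _ m (by omega)

/-- The pre-cell `⟨a⟩` of an `n`-atom `a`: `⟨a⟩_{±n} = {a}`, `⟨a⟩_{i-1} = (⟨a⟩_i)^±` and
`⟨a⟩_{-(i-1)} = (⟨a⟩_{-i})^∓`. -/
def atom {n : ℕ} (a : P.Atom n) : P.PreCell where
  part ε := P.down ε n {a}
  bounded := ⟨n + 1, fun m hm ε => down_eq_empty ε n _ m hm⟩

/-- The relation `x ◁ y` on `n`-atoms: `x⁺ ∩ y⁻ ≠ ∅`. -/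
def Precedes : ∀ {n : ℕ}, P.Atom n → P.Atom n → Prop
  | 0, _, _ => False
  | _ + 1, x, y => ∃ z, z ∈ P.face true x ∧ z ∈ P.face false y

/-- The relation `◁_U` on a set `U` of `n`-atoms: the transitive closure of the restriction of
`◁` to `U`. -/
def PrecedesIn {n : ℕ} (U : Set (P.Atom n)) : P.Atom n → P.Atom n → Prop :=
  Relation.TransGen fun x y => x ∈ U ∧ y ∈ U ∧ Precedes x y

/-- `V` is a segment of `U` for `◁_U`. -/
def IsSegment {n : ℕ} (U V : Set (P.Atom n)) : Prop :=
  V ⊆ U ∧ ∀ x y z, x ∈ V → z ∈ V → PrecedesIn U x y → PrecedesIn U y z → y ∈ V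

/-- Atoms `x`, `y` of dimensions `> k` are in torsion with respect to the `k`-cell `Z`. -/
def InTorsion {i j : ℕ} (k : ℕ) (x : P.Atom i) (y : P.Atom j) (Z : P.PreCell) : Prop :=
  (atom x).part true k ⊆ Z.part true k ∧
  (atom y).part false k ⊆ Z.part true k ∧
  Disjoint ((atom x).part true k) ((atom y).part false k) ∧
  (∃ u ∈ (atom x).part true k, ∃ v ∈ (atom y).part false k, PrecedesIn (Z.part true k) u v) ∧
  (∃ v ∈ (atom y).part false k, ∃ u ∈ (atom x).part true k, PrecedesIn (Z.part true k) v u)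

variable (P) in
/-- Torsion-free complexes: hypergraphs satisfying the five axioms below. -/
structure IsTorsionFree : Prop where
  /-- (non-emptiness) -/
  nonempty : ∀ (ε : Bool) (n : ℕ) (x : P.Atom (n + 1)), (P.face ε x).Nonempty
  /-- (acyclicity) the transitive closure of `◁` is irreflexive -/
  acyclic : ∀ (n : ℕ) (x : P.Atom n), ¬ Relation.TransGen Precedes x x
  /-- (relevance) `⟨x⟩` is a cell -/
  relevant : ∀ (n : ℕ) (x : P.Atom n), IsCell (atom x)
  /-- (segment condition) for every atom `x`, sign `ε`, and `k`-cell `X` with `k < dim x`, if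
  `⟨x⟩_{ε k} ⊆ X_k` then it is a segment of `X_k` -/
  segment : ∀ (ε : Bool) (n k : ℕ) (x : P.Atom n) (X : P.PreCell), k < n → IsCell X →
    X.bd false k = X → (atom x).part ε k ⊆ X.part true k →
    IsSegment (X.part true k) ((atom x).part ε k)
  /-- (torsion-freeness) no two atoms of dimension `> k` are in torsion with respect to a
  `k`-cell -/
  torsionFree : ∀ (i j k : ℕ) (x : P.Atom i) (y : P.Atom j) (Z : P.PreCell), k < i → k < j →
    IsCell Z → Z.bd false k = Z → ¬ InTorsion k x y Z

variable (P) in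
/-- The strict ω-category of all pre-cells. -/
def preCells : StrictOmegaCat.{u} where
  Cell := P.PreCell
  bd := PreCell.bd
  comp i b a _ := PreCell.comp i b a
  bd_bd_of_lt ε δ i j x hij := by
    ext σ k : 3
    simp only [PreCell.part_bd]
    grind
  bd_bd_of_le ε δ i j x hij := by
    ext σ k : 3
    simp only [PreCell.part_bd]
    grind
  exists_dim x := by
    obtain ⟨n, hn⟩ := x.bounded
    refine ⟨n, ?_⟩
    ext σ k : 3
    simp only [PreCell.part_bd]
    grind
  bd_false_comp i b a h := by
    ext σ k : 3
    simp only [PreCell.part_bd, PreCell.part_comp]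
    grind
  bd_true_comp i b a h := by
    have := PreCell.part_eq_of_bd_eq h
    ext σ k : 3
    simp only [PreCell.part_bd, PreCell.part_comp]
    grind
  bd_comp_of_lt ε i j b a h h' hij := by
    ext σ k : 3
    simp only [PreCell.part_bd, PreCell.part_comp]
    rcases lt_trichotomy k j with hk | hk | hk <;> rcases lt_trichotomy k i with hk' | hk' | hk' <;>
      cases σ <;> grind
  comp_id i x h := by
    ext σ k : 3
    simp only [PreCell.part_bd, PreCell.part_comp]
    cases σ <;> grind
  id_comp i x h := by
    ext σ k : 3
    simp only [PreCell.part_bd, PreCell.part_comp]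
    cases σ <;> grind
  assoc i c b a hab hbc h h' := by
    have h1 := PreCell.part_eq_of_bd_eq hab
    have h2 := PreCell.part_eq_of_bd_eq hbc
    ext σ k : 3
    simp only [PreCell.part_comp]
    cases σ <;> grind
  interchange i j a b c d hij hab hcd hac hbd h h' := by
    have h1 := PreCell.part_eq_of_bd_eq hab
    have h2 := PreCell.part_eq_of_bd_eq hcd
    have h3 := PreCell.part_eq_of_bd_eq hac
    have h4 := PreCell.part_eq_of_bd_eq hbd
    ext σ k : 3
    simp only [PreCell.part_comp]
    rcases lt_trichotomy k j with hk | hk | hk <;> rcases lt_trichotomy k i with hk' | hk' | hk' <;>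
      cases σ <;> grind

/-- Sources and targets of cells are cells: the cells form a globular subset of the pre-cells. -/
theorem IsCell.bd {c : P.PreCell} (hc : IsCell c) (ε : Bool) (i : ℕ) : IsCell (c.bd ε i) where
  finite δ j := by
    rw [PreCell.part_bd]
    split_ifs
    · exact hc.finite _ _
    · exact hc.finite _ _
    · exact Set.finite_empty
  forkFree δ j := by
    rw [PreCell.part_bd]
    split_ifs with h1 h2
    · exact hc.forkFree _ _
    · exact hc.forkFree _ _
    · obtain ⟨k, rfl⟩ : ∃ k, j = k + 1 := ⟨j - 1, by omega⟩
      intro u hu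
      exact absurd hu (Set.notMem_empty u)
  moves δ j := by
    have key : ∀ Z : Set (P.Atom j), P.Moves ∅ Z Z := fun Z => by
      constructor <;> simp [border, faces]
    simp only [PreCell.part_bd]
    rcases lt_trichotomy (j + 1) i with h | h | h
    · rw [if_pos h, if_pos (by omega), if_pos (by omega)]
      exact hc.moves _ _
    · rw [if_neg (by omega), if_pos h, if_pos (by omega), if_pos (by omega)]
      exact hc.moves _ _
    · rw [if_neg (by omega), if_neg (by omega)]
      rcases lt_or_eq_of_le (show i ≤ j by omega) with h' | rfl
      · rw [if_neg (by omega), if_neg (by omega), if_neg (by omega)]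
        exact key _
      · simpa using key _

variable (P) in
/-- The composite of composable cells of `P` is again a cell. -/
def CompClosed : Prop :=
  ∀ (i : ℕ) (d c : P.PreCell), IsCell d → IsCell c → c.bd true i = d.bd false i →
    IsCell (PreCell.comp i d c)

variable (P) in
/-- The strict ω-category `F P` of cells of `P`, a sub-ω-category of the pre-cells; it makes sense
as soon as composites of cells are cells. -/
def cells (hP : P.CompClosed) : StrictOmegaCat.{u} where
  Cell := {c : P.PreCell // IsCell c}
  bd ε i c := ⟨c.1.bd ε i, c.2.bd ε i⟩
  comp i d c h := ⟨PreCell.comp i d.1 c.1, hP i d.1 c.1 d.2 c.2 (congrArg Subtype.val h)⟩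
  bd_bd_of_lt ε δ i j x hij := Subtype.ext (P.preCells.bd_bd_of_lt ε δ i j x.1 hij)
  bd_bd_of_le ε δ i j x hij := Subtype.ext (P.preCells.bd_bd_of_le ε δ i j x.1 hij)
  exists_dim x := (P.preCells.exists_dim x.1).imp fun _ h => Subtype.ext h
  bd_false_comp i b a h :=
    Subtype.ext (P.preCells.bd_false_comp i b.1 a.1 (congrArg Subtype.val h))
  bd_true_comp i b a h :=
    Subtype.ext (P.preCells.bd_true_comp i b.1 a.1 (congrArg Subtype.val h))
  bd_comp_of_lt ε i j b a h h' hij := Subtype.ext (P.preCells.bd_comp_of_lt ε i j b.1 a.1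
    (congrArg Subtype.val h) (congrArg Subtype.val h') hij)
  comp_id i x h := Subtype.ext (P.preCells.comp_id i x.1 (congrArg Subtype.val h))
  id_comp i x h := Subtype.ext (P.preCells.id_comp i x.1 (congrArg Subtype.val h))
  assoc i c b a hab hbc h h' := Subtype.ext (P.preCells.assoc i c.1 b.1 a.1
    (congrArg Subtype.val hab) (congrArg Subtype.val hbc)
    (congrArg Subtype.val h) (congrArg Subtype.val h'))
  interchange i j a b c d hij hab hcd hac hbd h h' :=
    Subtype.ext (P.preCells.interchange i j a.1 b.1 c.1 d.1 hij
      (congrArg Subtype.val hab) (congrArg Subtype.val hcd) (congrArg Subtype.val hac)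
      (congrArg Subtype.val hbd) (congrArg Subtype.val h) (congrArg Subtype.val h'))

end OmegaHypergraph

/-! Closure under composition rests on gluing one atom: if `x⁻` lies in the top part `A` of an
`n`-cell, then `x⁺` misses `A`, and replacing `x⁻` by `x⁺` in `A` gives the top part of a cell with
the same lower parts (`AtomGluing`). This is proved by induction on `n`. By the segment condition
the top part splits as `V ∪ x⁻ ∪ W`, with `V` the outside predecessors of `x⁻`. As `⟨x⟩` is a cell,
`x⁺` and `x⁻` make the same move, so one may stand for the other between `V` and `W`. By acyclicity
a finite fork-free set can be glued atom by atom (`isTop_glued`). Two sets glued in succession are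
disjoint with fork-free union and act as that union (`glued_union`). Applied in each dimension above
`i`, this shows that `b ∘_i a` is a cell (`compStage_facts`, `compClosed`).

Hypercancellativity goes up through the dimensions. Once the lower parts agree, the parts of `a` and
`a'` make the same move inside one fork-free set, and a `◁`-maximal atom of their difference gives a
contradiction (`subset_of_moves`). The parts of `b` are then complements.

`Θ`-regularity holds for every hypercancellative ω-category without directed cycles (`IsLoopFree`),
and acyclicity gives `FP` the latter property. Objects of `Θ` are planar trees, a tree being the
suspension of its first branch wedged with the remaining branches. For a map `F` out of a tree there
are two cases. If the first two objects have the same image, loop-freeness makes `F` constant on the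
first branch, which can be collapsed. Otherwise one recurses into the first branch, mapped to a hom
ω-category, and into the remaining branches. A degeneracy of either restriction extends to the tree
(`Degenerates.left`, `Degenerates.right`). If both restrictions are injective, endpoints tell the
kinds of cells apart, and cancellation at dimension `0` recovers the factors of a cell crossing the
second object (`injective_cons`). -/

namespace OmegaHypergraph

/-! ### Elementary calculus of moves, gluing and down-closed subsets. -/

variable {P : OmegaHypergraph.{u}}

/-- The result of gluing `V` on `A`: the `V`-source border is replaced by the target border. -/
def glued {n : ℕ} (A : Set (P.Atom n)) (V : Set (P.Atom (n + 1))) : Set (P.Atom n) :=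
  (A \ P.border false V) ∪ P.border true V

theorem mem_glued {n : ℕ} {A : Set (P.Atom n)} {V : Set (P.Atom (n + 1))} {z : P.Atom n} :
    z ∈ glued A V ↔ (z ∈ A ∧ ¬ (z ∈ P.faces false V ∧ z ∉ P.faces true V)) ∨
      (z ∈ P.faces true V ∧ z ∉ P.faces false V) := Iff.rfl

theorem mem_border_false {n : ℕ} {V : Set (P.Atom (n + 1))} {z : P.Atom n} :
    z ∈ P.border false V ↔ z ∈ P.faces false V ∧ z ∉ P.faces true V := Iff.rfl

theorem mem_border_true {n : ℕ} {V : Set (P.Atom (n + 1))} {z : P.Atom n} :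
    z ∈ P.border true V ↔ z ∈ P.faces true V ∧ z ∉ P.faces false V := Iff.rfl

theorem mem_faces {n : ℕ} {ε : Bool} {V : Set (P.Atom (n + 1))} {z : P.Atom n} :
    z ∈ P.faces ε V ↔ ∃ s ∈ V, z ∈ P.face ε s := Iff.rfl

theorem mem_faces_union {n : ℕ} {ε : Bool} {V T : Set (P.Atom (n + 1))} {z : P.Atom n} :
    z ∈ P.faces ε (V ∪ T) ↔ z ∈ P.faces ε V ∨ z ∈ P.faces ε T := by
  simp only [mem_faces, Set.mem_union, or_and_right, exists_or]

theorem faces_mono {n : ℕ} {ε : Bool} {V T : Set (P.Atom (n + 1))} (h : V ⊆ T) :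
    P.faces ε V ⊆ P.faces ε T := fun _ ⟨s, hs, hz⟩ => ⟨s, h hs, hz⟩

theorem faces_singleton {n : ℕ} {ε : Bool} (x : P.Atom (n + 1)) :
    P.faces ε {x} = P.face ε x := by
  ext z; simp [mem_faces]

theorem Moves.glued_eq {n : ℕ} {V : Set (P.Atom (n + 1))} {X Y : Set (P.Atom n)}
    (h : P.Moves V X Y) : glued X V = Y := by
  rw [glued, h.1, h.2]
  ext z
  simp only [Set.mem_union, Set.mem_sdiff]
  tauto

theorem moves_glued {n : ℕ} {V : Set (P.Atom (n + 1))} {A : Set (P.Atom n)}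
    (h : P.border false V ⊆ A) (h' : Disjoint (P.faces true V) A) :
    P.Moves V A (glued A V) := by
  constructor
  · ext z
    have h1 := @h z
    have h2 : z ∈ P.faces true V → z ∉ A := fun a b => Set.disjoint_left.1 h' a b
    simp only [Set.mem_sdiff, mem_glued, mem_border_false] at *
    tauto
  · ext z
    have h1 := @h z
    have h2 : z ∈ P.faces true V → z ∉ A := fun a b => Set.disjoint_left.1 h' a b
    simp only [Set.mem_sdiff, mem_glued, mem_border_false, mem_border_true] at *
    tauto

/-- An element of `V⁻` is either removed with the source border or also in `V⁺`; in the latter case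
it is neither in `A` nor in the target border. -/
theorem disjoint_faces_glued {n : ℕ} {V : Set (P.Atom (n + 1))} {A : Set (P.Atom n)}
    (h' : Disjoint (P.faces true V) A) : Disjoint (P.faces false V) (glued A V) := by
  rw [Set.disjoint_left]
  intro z hz hz'
  have h2 : z ∈ P.faces true V → z ∉ A := fun a b => Set.disjoint_left.1 h' a b
  rw [mem_glued] at hz'
  tauto

theorem ForkFree.eq {n : ℕ} {V : Set (P.Atom (n + 1))} (h : P.ForkFree V) {ε : Bool}
    {u v : P.Atom (n + 1)} (hu : u ∈ V) (hv : v ∈ V) {z : P.Atom n} (hzu : z ∈ P.face ε u)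
    (hzv : z ∈ P.face ε v) : u = v := by
  by_contra hne
  exact Finset.disjoint_left.1 (h u hu v hv hne ε) hzu hzv

theorem ForkFree.mono {n : ℕ} {V W : Set (P.Atom (n + 1))} (h : P.ForkFree V) (hWV : W ⊆ V) :
    P.ForkFree W := fun u hu v hv => h u (hWV hu) v (hWV hv)

/-- `V₀` is closed under predecessors in `V`. -/
def DownClosed {n : ℕ} (V₀ V : Set (P.Atom n)) : Prop :=
  V₀ ⊆ V ∧ ∀ w ∈ V, ∀ v ∈ V₀, Precedes w v → w ∈ V₀

/-- An atom of `V` producing an element consumed by `V₀` precedes an atom of `V₀`, hence is in `V₀`.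
-/
theorem DownClosed.border_subset {n : ℕ} {V₀ V : Set (P.Atom (n + 1))} (h : DownClosed V₀ V) :
    P.border false V₀ ⊆ P.border false V := by
  rintro z ⟨⟨v, hv, hzv⟩, hz⟩
  refine ⟨⟨v, h.1 hv, hzv⟩, ?_⟩
  rintro ⟨w, hw, hzw⟩
  exact hz ⟨w, h.2 w hw v hv ⟨z, hzw, hzv⟩, hzw⟩

/-- What the rest of `V` needs is either produced by `V₀` or was in the source border of `V` from
the start. By fork-freeness `V₀` does not consume it. -/
theorem DownClosed.border_diff_subset {n : ℕ} {V₀ V : Set (P.Atom (n + 1))} (h : DownClosed V₀ V)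
    (hV : P.ForkFree V) {A : Set (P.Atom n)} (hA : P.border false V ⊆ A) :
    P.border false (V \ V₀) ⊆ glued A V₀ := by
  rintro z ⟨⟨v, hv, hzv⟩, hz⟩
  have hz0 : z ∉ P.faces false V₀ := by
    rintro ⟨w, hw, hzw⟩
    obtain rfl := hV.eq (h.1 hw) hv.1 hzw hzv
    exact hv.2 hw
  rw [mem_glued]
  by_cases hz1 : z ∈ P.faces true V₀
  · exact Or.inr ⟨hz1, hz0⟩
  · refine Or.inl ⟨hA ⟨⟨v, hv.1, hzv⟩, ?_⟩, fun h => hz0 h.1⟩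
    rintro ⟨w, hw, hzw⟩
    by_cases hw0 : w ∈ V₀
    · exact hz1 ⟨w, hw0, hzw⟩
    · exact hz ⟨w, ⟨hw, hw0⟩, hzw⟩

/-! ### First consequences of acyclicity and non-emptiness. -/

namespace IsTorsionFree

variable (hP : P.IsTorsionFree)
include hP

theorem isStrictOrder (n : ℕ) :
    IsStrictOrder (P.Atom n) (Relation.TransGen Precedes) where
  irrefl := hP.acyclic n
  trans _ _ _ := Relation.TransGen.trans

theorem isStrictOrder_swap (n : ℕ) :
    IsStrictOrder (P.Atom n) (fun x y => Relation.TransGen Precedes y x) where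
  irrefl := hP.acyclic n
  trans _ _ _ h h' := Relation.TransGen.trans h' h

theorem exists_minimal {n : ℕ} {V : Set (P.Atom n)} (hV : V.Finite) (hne : V.Nonempty) :
    ∃ x ∈ V, ∀ y ∈ V, ¬ Relation.TransGen Precedes y x := by
  have := hP.isStrictOrder n
  have hw := hV.wellFoundedOn (r := Relation.TransGen Precedes)
  obtain ⟨x, hx⟩ := hne
  obtain ⟨m, -, hm⟩ := WellFounded.has_min hw Set.univ ⟨⟨x, hx⟩, trivial⟩
  exact ⟨m.1, m.2, fun y hy h => hm ⟨y, hy⟩ trivial h⟩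

theorem exists_maximal {n : ℕ} {V : Set (P.Atom n)} (hV : V.Finite) (hne : V.Nonempty) :
    ∃ x ∈ V, ∀ y ∈ V, ¬ Relation.TransGen Precedes x y := by
  have := hP.isStrictOrder_swap n
  have hw := hV.wellFoundedOn (r := fun x y => Relation.TransGen Precedes y x)
  obtain ⟨x, hx⟩ := hne
  obtain ⟨m, -, hm⟩ := WellFounded.has_min hw Set.univ ⟨⟨x, hx⟩, trivial⟩
  exact ⟨m.1, m.2, fun y hy h => hm ⟨y, hy⟩ trivial h⟩

theorem not_precedes_self {n : ℕ} (x : P.Atom n) : ¬ Precedes x x :=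
  fun h => hP.acyclic n x (.single h)

theorem disjoint_face {n : ℕ} (x : P.Atom (n + 1)) {z : P.Atom n} (h : z ∈ P.face true x) :
    z ∉ P.face false x := fun h' => hP.not_precedes_self x ⟨z, h, h'⟩

theorem border_singleton {n : ℕ} (ε : Bool) (x : P.Atom (n + 1)) :
    P.border ε {x} = P.face ε x := by
  ext z
  simp only [border, faces_singleton, Set.mem_sdiff, Finset.mem_coe, and_iff_left_iff_imp]
  have := hP.disjoint_face x (z := z)
  cases ε <;> simp <;> tauto

theorem atom_part {n : ℕ} (ε : Bool) (x : P.Atom (n + 1)) :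
    (atom x).part ε n = P.face ε x := by
  change Function.update (P.down ε n (P.border ε {x})) (n + 1) {x} n = _
  rw [Function.update_of_ne (by omega), hP.border_singleton]
  cases n <;> exact Function.update_self ..

/-- The source of a `◁`-minimal atom of `S` is nonempty, and nothing in `S` can cancel it. -/
theorem eq_empty_of_border {n : ℕ} {S : Set (P.Atom (n + 1))} (hS : S.Finite)
    (h : P.border false S = ∅) : S = ∅ := by
  by_contra hne
  obtain ⟨x, hx, hmin⟩ := hP.exists_minimal hS (Set.nonempty_iff_ne_empty.2 hne)
  obtain ⟨z, hz⟩ := hP.nonempty false n x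
  have : z ∈ P.border false S := by
    refine ⟨⟨x, hx, hz⟩, ?_⟩
    rintro ⟨y, hy, hzy⟩
    exact hmin y hy (.single ⟨z, hzy, hz⟩)
  rw [h] at this
  exact this

end IsTorsionFree

/-! ### Top parts of cells over fixed lower parts. -/

/-- `S` is the top part of an `n`-cell whose parts in dimensions `< n` are given by `c`. -/
def IsTop (c : Bool → ∀ i, Set (P.Atom i)) : ∀ n, Set (P.Atom n) → Prop
  | 0, S => ∃ x, S = {x}
  | n + 1, S => S.Finite ∧ P.ForkFree S ∧ P.Moves S (c false n) (c true n) ∧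
      IsTop c n (c false n) ∧ IsTop c n (c true n)

variable {c : Bool → ∀ i, Set (P.Atom i)}

theorem IsTop.finite : ∀ {n : ℕ} {S : Set (P.Atom n)}, IsTop c n S → S.Finite
  | 0, _, ⟨_, h⟩ => h ▸ Set.finite_singleton _
  | _ + 1, _, h => h.1

theorem IsTop.forkFree : ∀ {n : ℕ} {S : Set (P.Atom n)}, IsTop c n S → P.ForkFree S
  | 0, _, h => h
  | _ + 1, _, h => h.2.1

theorem IsTop.lower : ∀ {n : ℕ} {S : Set (P.Atom n)}, IsTop c n S → ∀ ε i, i < n →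
    IsTop c i (c ε i)
  | 0, _, _, _, _, h => absurd h (by omega)
  | n + 1, S, h, ε, i, hi => by
    rcases Nat.lt_succ_iff_lt_or_eq.1 hi with h' | rfl
    · exact h.2.2.2.1.lower ε i h'
    · cases ε
      exacts [h.2.2.2.1, h.2.2.2.2]

theorem isTop_of_isCell {c : P.PreCell} (hc : IsCell c) : ∀ ε n, IsTop c.part n (c.part ε n)
  | ε, 0 => hc.forkFree ε 0
  | _, _ + 1 => ⟨hc.finite _ _, hc.forkFree _ _, hc.moves _ _, isTop_of_isCell hc _ _,
      isTop_of_isCell hc _ _⟩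

theorem isTop_congr {c c' : Bool → ∀ i, Set (P.Atom i)} : ∀ {n : ℕ} {S : Set (P.Atom n)},
    (∀ ε i, i < n → c ε i = c' ε i) → IsTop c n S → IsTop c' n S
  | 0, _, _, h => h
  | n + 1, _, h, hS => by
    have h' : ∀ ε i, i < n → c ε i = c' ε i := fun ε i hi => h ε i (by omega)
    rw [IsTop, h _ _ (Nat.lt_succ_self n), h _ _ (Nat.lt_succ_self n)] at hS
    exact ⟨hS.1, hS.2.1, hS.2.2.1, isTop_congr h' hS.2.2.2.1, isTop_congr h' hS.2.2.2.2⟩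

/-- The pre-`n`-cell with top part `S` and lower parts `c`. -/
def topCell (c : Bool → ∀ i, Set (P.Atom i)) (n : ℕ) (S : Set (P.Atom n)) : P.PreCell where
  part ε := Function.update (fun i => if i < n then c ε i else ∅) n S
  bounded := ⟨n + 1, fun m hm ε => by
    rw [Function.update_of_ne (by omega), if_neg (by omega)]⟩

theorem topCell_part_self (n : ℕ) (S : Set (P.Atom n)) (ε : Bool) :
    (topCell c n S).part ε n = S := by simp [topCell]

theorem topCell_part_of_lt {n i : ℕ} (h : i < n) (S : Set (P.Atom n)) (ε : Bool) :
    (topCell c n S).part ε i = c ε i := by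
  simp [topCell, h, h.ne]

theorem topCell_part_of_gt {n i : ℕ} (h : n < i) (S : Set (P.Atom n)) (ε : Bool) :
    (topCell c n S).part ε i = ∅ := by
  simp [topCell, h.le, h.ne']

theorem topCell_bd (n : ℕ) (S : Set (P.Atom n)) : (topCell c n S).bd false n = topCell c n S := by
  ext ε i : 3
  rw [PreCell.part_bd]
  split_ifs with h1 h2
  · rfl
  · subst h2
    rw [topCell_part_self, topCell_part_self]
  · rw [topCell_part_of_gt (by omega)]

theorem forkFree_empty {n : ℕ} : P.ForkFree (∅ : Set (P.Atom (n + 1))) :=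
  fun _ hu => absurd hu (Set.notMem_empty _)

theorem moves_empty {n : ℕ} (Z : Set (P.Atom n)) : P.Moves ∅ Z Z := by
  constructor <;> simp [border, faces]

theorem isCell_topCell {n : ℕ} {S : Set (P.Atom n)} (h : IsTop c n S) :
    IsCell (topCell c n S) := by
  have key : ∀ ε i, i ≤ n → IsTop c i ((topCell c n S).part ε i) := by
    intro ε i hi
    rcases hi.lt_or_eq with hi | rfl
    · rw [topCell_part_of_lt hi]
      exact h.lower ε i hi
    · rwa [topCell_part_self]
  refine ⟨fun ε i => ?_, fun ε i => ?_, fun ε i => ?_⟩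
  · rcases le_or_gt i n with hi | hi
    · exact (key ε i hi).finite
    · rw [topCell_part_of_gt hi]
      exact Set.finite_empty
  · rcases le_or_gt i n with hi | hi
    · exact (key ε i hi).forkFree
    · obtain ⟨k, rfl⟩ : ∃ k, i = k + 1 := ⟨i - 1, by omega⟩
      rw [topCell_part_of_gt hi]
      exact forkFree_empty
  · rcases lt_or_ge i n with hi | hi
    · have := (key ε (i + 1) hi).2.2.1
      rwa [topCell_part_of_lt hi, topCell_part_of_lt hi]
    · rw [topCell_part_of_gt (show n < i + 1 by omega)]
      rcases hi.lt_or_eq with hi | rfl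
      · rw [topCell_part_of_gt hi, topCell_part_of_gt hi]
        exact moves_empty _
      · rw [topCell_part_self, topCell_part_self]
        exact moves_empty _

variable (P) in
/-- A single atom can be glued on any `n`-cell whose top part contains its source. -/
def AtomGluing (n : ℕ) : Prop :=
  ∀ (c : Bool → ∀ i, Set (P.Atom i)) (A : Set (P.Atom n)) (x : P.Atom (n + 1)), IsTop c n A →
    (P.face false x : Set (P.Atom n)) ⊆ A →
    Disjoint (P.face true x : Set (P.Atom n)) A ∧ IsTop c n ((A \ P.face false x) ∪ P.face true x)

/-! ### Gluing finite fork-free sets, given the gluing of single atoms. -/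

namespace IsTorsionFree

variable (hP : P.IsTorsionFree)
include hP

/-- Induction on the number of atoms: a `◁`-minimal `x` in `V` has its whole source in the border of
`V`, hence in `A`, so it can be glued first. Atom gluing in dimension `n` is kept as a hypothesis
because this lemma serves in deriving atom gluing in dimension `n + 1`. -/
theorem isTop_glued {n : ℕ} (hn : P.AtomGluing n) {A : Set (P.Atom n)}
    {V : Set (P.Atom (n + 1))} (hA : IsTop c n A) (hV : V.Finite) (hVf : P.ForkFree V)
    (hVA : P.border false V ⊆ A) : IsTop c n (glued A V) ∧ Disjoint (P.faces true V) A := by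
  induction hk : V.ncard generalizing V A with
  | zero =>
    obtain rfl := (Set.ncard_eq_zero hV).1 hk
    have := (moves_empty A).glued_eq
    rw [this]
    exact ⟨hA, by simp [faces]⟩
  | succ k ih =>
    have hne : V.Nonempty := by
      rw [← Set.ncard_pos hV]; omega
    obtain ⟨x, hx, hmin⟩ := hP.exists_minimal hV hne
    have hdown : DownClosed {x} V := by
      refine ⟨by simpa using hx, ?_⟩
      rintro w hw v rfl h
      exact absurd (.single h) (hmin w hw)
    have hxA := hdown.border_subset.trans hVA
    rw [hP.border_singleton] at hxA
    obtain ⟨hd, hA'⟩ := hn c A x hA hxA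
    have hdiff := hdown.border_diff_subset hVf hVA
    have hglue : glued A {x} = (A \ P.face false x) ∪ P.face true x := by
      rw [glued, hP.border_singleton, hP.border_singleton]
    rw [hglue] at hdiff
    obtain ⟨h1, h2⟩ := ih hA' (hV.subset Set.sdiff_subset) (hVf.mono Set.sdiff_subset) hdiff
      (by rw [Set.ncard_sdiff_singleton_of_mem hx]; omega)
    have hfaces : ∀ ε z, z ∈ P.faces ε V ↔ z ∈ P.face ε x ∨ z ∈ P.faces ε (V \ {x}) := by
      intro ε z
      conv_lhs => rw [← Set.union_sdiff_cancel (Set.singleton_subset_iff.2 hx)]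
      rw [mem_faces_union, faces_singleton, Finset.mem_coe]
    have hfork : ∀ ε z, z ∈ P.face ε x → z ∉ P.faces ε (V \ {x}) := by
      rintro ε z hz ⟨w, hw, hzw⟩
      exact hw.2 (hVf.eq hw.1 hx hzw hz)
    have hprec : ∀ z, z ∈ P.face false x → z ∉ P.faces true (V \ {x}) := by
      rintro z hz ⟨w, hw, hzw⟩
      exact hmin w hw.1 (.single ⟨z, hzw, hz⟩)
    rw [Set.disjoint_left] at hd h2
    have hdis : Disjoint (P.faces true V) A := by
      rw [Set.disjoint_left]
      intro z hz hzA
      have := hfaces true z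
      have := hprec z
      have := @h2 z
      have := @hd z
      simp only [Set.mem_union, Set.mem_sdiff, Finset.mem_coe] at *
      tauto
    refine ⟨?_, hdis⟩
    have : glued A V = glued ((A \ P.face false x) ∪ P.face true x) (V \ {x}) := by
      ext z
      have := hfaces true z
      have := hfaces false z
      have := hprec z
      have := hfork true z
      have := hfork false z
      have := @h2 z
      have := @hd z
      have := hP.disjoint_face x (z := z)
      have := @hxA z
      simp only [mem_glued, Set.mem_union, Set.mem_sdiff, Finset.mem_coe] at *
      grind
    rw [this]
    exact h1

/-- Suppose `z ∈ t⁺ ∩ v⁻`, so that `t ◁ v`. The part of `T` below `t` can then be glued before any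
atom of `V` above `v`. At that stage `z` is still present, waiting to be consumed by `v`, yet `t`
would produce it again. -/
theorem disjoint_faces_of_glued {n : ℕ} (hn : P.AtomGluing n) {A : Set (P.Atom n)}
    {V T : Set (P.Atom (n + 1))} (hA : IsTop c n A) (hV : V.Finite) (hVf : P.ForkFree V)
    (hVA : P.border false V ⊆ A) (hT : T.Finite) (hTf : P.ForkFree T)
    (hTA : P.border false T ⊆ glued A V) : Disjoint (P.faces true T) (P.faces false V) := by
  rw [Set.disjoint_left]
  rintro z ⟨t, ht, hzt⟩ ⟨v, hv, hzv⟩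
  let V₀ : Set (P.Atom (n + 1)) := {w ∈ V | ¬ Relation.ReflTransGen Precedes v w}
  let T₀ : Set (P.Atom (n + 1)) := {w ∈ T | Relation.ReflTransGen Precedes w t}
  have hV₀ : DownClosed V₀ V :=
    ⟨fun w hw => hw.1, fun w hw v' hv' h => ⟨hw, fun h' => hv'.2 (h'.tail h)⟩⟩
  have hT₀ : DownClosed T₀ T :=
    ⟨fun w hw => hw.1, fun w hw v' hv' h => ⟨hw, hv'.2.head h⟩⟩
  have hA' := (hP.isTop_glued hn hA (hV.subset hV₀.1) (hVf.mono hV₀.1)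
    (hV₀.border_subset.trans hVA)).1
  -- The atoms of `V` outside `V₀` all lie above `v`, so none of them produces `z` without a cycle.
  have hzA' : z ∈ glued A V₀ := by
    refine hV₀.border_diff_subset hVf hVA ⟨⟨v, ⟨hv, fun h => h.2 .refl⟩, hzv⟩, ?_⟩
    rintro ⟨w, hw, hzw⟩
    have h1 : Relation.ReflTransGen Precedes v w := by
      by_contra h1
      exact hw.2 ⟨hw.1, h1⟩
    exact hP.acyclic _ v (Relation.TransGen.tail' h1 ⟨z, hzw, hzv⟩)
  have hTA' : P.border false T₀ ⊆ glued A V₀ := by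
    intro y hy
    have h1 := hTA (hT₀.border_subset hy)
    obtain ⟨⟨t', ht', hyt'⟩, -⟩ := hy
    -- If `w` were above `v`, then `v ≤ w ◁ t' ≤ t ◁ v` would be a cycle.
    have h2 : ∀ w ∈ V, y ∈ P.face true w → w ∈ V₀ := by
      refine fun w hw hyw => ⟨hw, fun h => ?_⟩
      exact hP.acyclic _ v (Relation.TransGen.tail' ((h.tail ⟨y, hyw, hyt'⟩).trans ht'.2)
        ⟨z, hzt, hzv⟩)
    have h3 : y ∈ P.faces true V → y ∈ P.faces true V₀ :=
      fun ⟨w, hw, hyw⟩ => ⟨w, h2 w hw hyw, hyw⟩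
    have h4 : y ∈ P.faces true V₀ → y ∈ P.faces true V := fun h => faces_mono hV₀.1 h
    have h5 : y ∈ P.faces false V₀ → y ∈ P.faces false V := fun h => faces_mono hV₀.1 h
    rw [mem_glued] at h1 ⊢
    tauto
  have := (hP.isTop_glued hn hA' (hT.subset hT₀.1) (hTf.mono hT₀.1) hTA').2
  exact Set.disjoint_left.1 this ⟨t, ⟨ht, .refl⟩, hzt⟩ hzA'

/-- Gluing successively two sets of atoms amounts to gluing their union. -/
theorem glued_union {n : ℕ} (hn : P.AtomGluing n) {A : Set (P.Atom n)}
    {V T : Set (P.Atom (n + 1))} (hA : IsTop c n A) (hV : V.Finite) (hVf : P.ForkFree V)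
    (hVA : P.border false V ⊆ A) (hT : T.Finite) (hTf : P.ForkFree T)
    (hTA : P.border false T ⊆ glued A V) :
    P.ForkFree (V ∪ T) ∧ Disjoint V T ∧ P.border false (V ∪ T) ⊆ A ∧
      glued A (V ∪ T) = glued (glued A V) T := by
  obtain ⟨hA', h1⟩ := hP.isTop_glued hn hA hV hVf hVA
  have h2 := disjoint_faces_glued h1
  have h3 := (hP.isTop_glued hn hA' hT hTf hTA).2
  have h4 := hP.disjoint_faces_of_glued hn hA hV hVf hVA hT hTf hTA
  rw [Set.disjoint_left] at h1 h2 h3 h4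
  -- An element of `V⁻` is absent from `glued A V`, so it can lie in `T⁻` only if it lies in `T⁺`,
  -- against `h4`. An element of `V⁺` is in `glued A V` or in `V⁻`; it is kept out of `T⁺` by `h3`
  -- or `h4`.
  have key : ∀ ε z, z ∈ P.faces ε V → z ∉ P.faces ε T := by
    intro ε z
    have := @h1 z
    have := @h2 z
    have := @h3 z
    have := @h4 z
    have := @hVA z
    have := @hTA z
    cases ε <;> simp only [mem_glued, mem_border_false] at * <;> tauto
  refine ⟨?_, ?_, ?_, ?_⟩
  · rintro u (hu | hu) v (hv | hv) huv ε
    · exact hVf u hu v hv huv ε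
    · exact Finset.disjoint_left.2 fun z hz hz' => key ε z ⟨u, hu, hz⟩ ⟨v, hv, hz'⟩
    · exact Finset.disjoint_left.2 fun z hz hz' => key ε z ⟨v, hv, hz'⟩ ⟨u, hu, hz⟩
    · exact hTf u hu v hv huv ε
  · rw [Set.disjoint_left]
    intro v hv hv'
    obtain ⟨z, hz⟩ := hP.nonempty false n v
    exact key false z ⟨v, hv, hz⟩ ⟨v, hv', hz⟩
  · intro z
    have := @hVA z
    have := @hTA z
    simp only [mem_border_false, mem_glued, mem_faces_union] at *
    tauto
  · ext z
    have := @h1 z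
    have := @h2 z
    have := @h3 z
    have := @h4 z
    have := @hVA z
    have := @hTA z
    clear h1 h2 h3 h4 key
    simp only [mem_border_false, mem_glued, mem_faces_union] at *
    grind

end IsTorsionFree
end OmegaHypergraph

namespace OmegaHypergraph

variable {P : OmegaHypergraph.{u}} {c : Bool → ∀ i, Set (P.Atom i)}

/-! ### Gluing a single atom, by induction on dimension. -/

namespace IsTorsionFree

variable (hP : P.IsTorsionFree)
include hP

theorem atomGluing_zero : P.AtomGluing 0 := by
  rintro c A x ⟨a, rfl⟩ hx
  obtain ⟨b, hb⟩ := hP.nonempty false 0 x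
  obtain rfl : b = a := hx hb
  have hd : Disjoint (P.face true x : Set (P.Atom 0)) {b} := by
    rw [Set.disjoint_singleton_right]
    exact fun h => hP.disjoint_face x h hb
  refine ⟨hd, ?_⟩
  -- Fork-freeness in dimension `0` means being a singleton, so `x⁺` is one because `⟨x⟩` is a cell.
  obtain ⟨y, hy⟩ := (hP.relevant 1 x).forkFree true 0
  rw [hP.atom_part] at hy
  refine ⟨y, ?_⟩
  rw [hy, Set.sdiff_eq_empty.2, Set.empty_union]
  simpa using hb

/-- The move made by `X` factors through `V`, `U = x⁻` and `W` in this order. Putting `T = x⁺` in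
place of `U` changes no border, so `V`, `T`, `W` can be glued in succession with the same result,
and `glued_union` makes their union fork-free. -/
theorem atomGluing_succ {n : ℕ} (hn : P.AtomGluing n) : P.AtomGluing (n + 1) := by
  intro c X x hX hxX
  have hseg : IsSegment X (P.face false x) := by
    have := hP.segment false (n + 2) (n + 1) x (topCell c (n + 1) X) (by omega)
      (isCell_topCell hX) (topCell_bd _ _)
    rw [topCell_part_self, hP.atom_part] at this
    exact this hxX
  have hXfin := hX.1
  have hXf := hX.2.1
  have hmov := hX.2.2.1
  have hA0 := hX.2.2.2.1
  have hXA : P.border false X ⊆ c false n := hmov.1 ▸ Set.sdiff_subset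
  set U : Set (P.Atom (n + 1)) := (P.face false x : Set (P.Atom (n + 1))) with hU
  set T : Set (P.Atom (n + 1)) := (P.face true x : Set (P.Atom (n + 1))) with hT
  have hmU := (hP.relevant _ x).moves false n
  have hmT := (hP.relevant _ x).moves true n
  rw [hP.atom_part, ← hU] at hmU
  rw [hP.atom_part, ← hT] at hmT
  have hTf : P.ForkFree T := by
    have := (hP.relevant _ x).forkFree true (n + 1)
    rwa [hP.atom_part] at this
  have hTfin : T.Finite := Finset.finite_toSet _
  let V : Set (P.Atom (n + 1)) := {v ∈ X | v ∉ U ∧ ∃ y ∈ U, PrecedesIn X v y}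
  have hV : DownClosed V X := by
    refine ⟨fun _ h => h.1, ?_⟩
    rintro w hw v ⟨hv, hvU, y, hy, hvy⟩ h
    have hwv : PrecedesIn X w v := .single ⟨hw, hv, h⟩
    -- A predecessor `w` of `v` lying in `U` would place `v` between two elements of the segment
    -- `U`.
    exact ⟨hw, fun hwU => hvU (hseg.2 w v y hwU hy hwv hvy), y, hy, hwv.trans hvy⟩
  have hUX : U ⊆ X \ V := fun y hy => ⟨hxX hy, fun h => h.2.1 hy⟩
  have hUd : DownClosed U (X \ V) := by
    refine ⟨hUX, fun w hw v hv h => ?_⟩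
    by_contra hwU
    exact hw.2 ⟨hw.1, hwU, v, hv, .single ⟨hw.1, hxX hv, h⟩⟩
  have hVfin := hXfin.subset hV.1
  have hVf := hXf.mono hV.1
  have hVA := hV.border_subset.trans hXA
  obtain ⟨hA, -⟩ := hP.isTop_glued hn hA0 hVfin hVf hVA
  have hXV := hV.border_diff_subset hXf hXA
  have hXVf : P.ForkFree (X \ V) := hXf.mono Set.sdiff_subset
  have hUA := hUd.border_subset.trans hXV
  have hW := hUd.border_diff_subset hXVf hXV
  set W := (X \ V) \ U with hWdef
  have hWfin : W.Finite := hXfin.subset (Set.sdiff_subset.trans Set.sdiff_subset)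
  have hWf : P.ForkFree W := hXVf.mono Set.sdiff_subset
  -- The two parts of `⟨x⟩` in dimension `n + 1` move the same set to the same set.
  have hTU : P.border false T = P.border false U := by rw [hmT.1, hmU.1]
  have hTU' : P.border true T = P.border true U := by rw [hmT.2, hmU.2]
  have hglue : ∀ A : Set (P.Atom n), glued A T = glued A U := by
    intro A
    rw [glued, glued, hTU, hTU']
  obtain ⟨f1, d1, b1, g1⟩ := hP.glued_union hn hA0 hVfin hVf hVA
    (hXfin.subset hxX) (hXf.mono hxX) hUA
  obtain ⟨-, -, -, g2⟩ := hP.glued_union hn hA0 (hVfin.union (hXfin.subset hxX)) f1 b1 hWfin hWf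
    (by rwa [g1])
  obtain ⟨f1', d1', b1', g1'⟩ := hP.glued_union hn hA0 hVfin hVf hVA hTfin hTf (by rwa [hTU])
  obtain ⟨f2, d2, b2, g2'⟩ := hP.glued_union hn hA0 (hVfin.union hTfin) f1' b1' hWfin hWf
    (by rwa [g1', hglue])
  have hXeq : V ∪ U ∪ W = X := by
    ext y
    have := @hV.1 y
    have := @hxX y
    simp only [hWdef, Set.mem_union, Set.mem_sdiff] at *
    tauto
  have hTUd : ∀ y, y ∈ T → y ∉ U := fun y => hP.disjoint_face x
  have hVU : ∀ y, y ∈ V → y ∉ U := fun y h => h.2.1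
  have hfinal : (X \ U) ∪ T = V ∪ T ∪ W := by
    ext y
    have := @hV.1 y
    have := hVU y
    simp only [hWdef, Set.mem_union, Set.mem_sdiff] at *
    tauto
  refine ⟨?_, ?_⟩
  · rw [Set.disjoint_left] at *
    intro y hy hyX
    have := hTUd y hy
    have := @d1' y
    have := @d2 y
    simp only [hWdef, Set.mem_union, Set.mem_sdiff] at *
    tauto
  · rw [hfinal]
    refine ⟨(hVfin.union hTfin).union hWfin, f2, ?_, hX.2.2.2⟩
    have hfin := (hP.isTop_glued hn hA0 ((hVfin.union hTfin).union hWfin) f2 b2).2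
    have hm := moves_glued b2 hfin
    -- Gluing `V`, `T`, `W` is rewritten as gluing `V`, `U`, `W`, that is, as gluing `X`.
    rw [g2', g1', hglue, ← g1, ← g2, hXeq, hmov.glued_eq] at hm
    exact hm

theorem atomGluing : ∀ n, P.AtomGluing n
  | 0 => hP.atomGluing_zero
  | n + 1 => hP.atomGluing_succ (atomGluing n)

end IsTorsionFree

/-! ### Composites of cells are cells. -/

/-- In dimension `j ≥ i`, gluing the cells `a` and `b` one after the other on the source of the
precell `b ∘_i a` passes through some `M` and results in its target. -/
structure CompStage (i : ℕ) (b a : P.PreCell) (j : ℕ) (M : Set (P.Atom j)) : Prop where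
  isTop : ∀ ε, IsTop (PreCell.comp i b a).part j ((PreCell.comp i b a).part ε j)
  left_subset : a.part true j ⊆ M
  right_subset : b.part false j ⊆ M
  left_border : ∀ S, P.Moves S (a.part false j) (a.part true j) →
    P.border false S ⊆ (PreCell.comp i b a).part false j
  left_glued : ∀ S, P.Moves S (a.part false j) (a.part true j) →
    glued ((PreCell.comp i b a).part false j) S = M
  right_border : ∀ S, P.Moves S (b.part false j) (b.part true j) → P.border false S ⊆ M
  right_glued : ∀ S, P.Moves S (b.part false j) (b.part true j) →
    glued M S = (PreCell.comp i b a).part true j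

theorem PreCell.comp_part_of_gt {i j : ℕ} (h : i < j) (ε : Bool) (b a : P.PreCell) :
    (PreCell.comp i b a).part ε j = a.part ε j ∪ b.part ε j := by
  rw [PreCell.part_comp, if_neg (by omega), if_neg (by omega)]

theorem PreCell.comp_part_of_lt {i j : ℕ} (h : j < i) (ε : Bool) (b a : P.PreCell) :
    (PreCell.comp i b a).part ε j = a.part ε j := by
  rw [PreCell.part_comp, if_pos h]

theorem PreCell.comp_part_false (i : ℕ) (b a : P.PreCell) :
    (PreCell.comp i b a).part false i = a.part false i := by
  rw [PreCell.part_comp, if_neg (by omega), if_pos rfl]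

theorem PreCell.comp_part_true (i : ℕ) (b a : P.PreCell) :
    (PreCell.comp i b a).part true i = b.part true i := by
  rw [PreCell.part_comp, if_neg (by omega), if_pos rfl]

theorem compStage_self {i : ℕ} {b a : P.PreCell} (hb : IsCell b) (ha : IsCell a)
    (h : a.bd true i = b.bd false i) : CompStage i b a i (a.part true i) := by
  obtain ⟨h1, h2⟩ := PreCell.part_eq_of_bd_eq h
  refine ⟨?_, subset_rfl, h2 ▸ subset_rfl, ?_, ?_, ?_, ?_⟩
  · rintro (_ | _)
    · rw [PreCell.comp_part_false]
      exact isTop_congr (fun ε j hj => (PreCell.comp_part_of_lt hj ε b a).symm)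
        (isTop_of_isCell ha false i)
    · rw [PreCell.comp_part_true]
      refine isTop_congr (fun ε j hj => ?_) (isTop_of_isCell hb true i)
      rw [PreCell.comp_part_of_lt hj, h1 _ _ hj]
  · intro S hS
    rw [PreCell.comp_part_false, hS.1]
    exact Set.sdiff_subset
  · intro S hS
    rw [PreCell.comp_part_false, hS.glued_eq]
  · intro S hS
    rw [h2, hS.1]
    exact Set.sdiff_subset
  · intro S hS
    rw [PreCell.comp_part_true, h2, hS.glued_eq]

namespace IsTorsionFree

variable (hP : P.IsTorsionFree)
include hP

/-- The parts of `a` and then of `b` in dimension `j + 1` are glued in succession on the source of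
the composite. As `CompStage` speaks of every set making the given move, the signs of the two parts
can be chosen independently. -/
theorem compStage_facts {i j : ℕ} {b a : P.PreCell} {M : Set (P.Atom j)} (hij : i ≤ j)
    (hb : IsCell b) (ha : IsCell a) (h : CompStage i b a j M) (ε : Bool) :
    IsTop (PreCell.comp i b a).part (j + 1) ((PreCell.comp i b a).part ε (j + 1)) ∧
    (∀ δ, Disjoint (a.part ε (j + 1)) (b.part δ (j + 1))) ∧
    Disjoint (P.faces true (b.part ε (j + 1))) (a.part true j) ∧
    Disjoint (P.faces false (a.part ε (j + 1))) (b.part false j) := by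
  have hn := hP.atomGluing j
  have hma := ha.moves ε j
  have hmb := fun δ => hb.moves δ j
  have hga := h.left_glued _ hma
  have hE := h.isTop false
  have hfa := ha.finite ε (j + 1)
  have hffa := ha.forkFree ε (j + 1)
  have hab := h.left_border _ hma
  have g := hP.isTop_glued hn hE hfa hffa hab
  have hM := g.1
  rw [hga] at hM
  have hu := fun δ => hP.glued_union hn hE hfa hffa hab (hb.finite δ (j + 1))
    (hb.forkFree δ (j + 1)) (by rw [hga]; exact h.right_border _ (hmb δ))
  refine ⟨?_, fun δ => (hu δ).2.1, ?_, ?_⟩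
  · rw [PreCell.comp_part_of_gt (by omega)]
    have hfin := hfa.union (hb.finite ε (j + 1))
    refine ⟨hfin, (hu ε).1, ?_, h.isTop false, h.isTop true⟩
    have := moves_glued (hu ε).2.2.1 (hP.isTop_glued hn hE hfin (hu ε).1 (hu ε).2.2.1).2
    rwa [(hu ε).2.2.2, hga, h.right_glued _ (hmb ε)] at this
  · exact (hP.isTop_glued hn hM (hb.finite ε (j + 1)) (hb.forkFree ε (j + 1))
      (h.right_border _ (hmb ε))).2.mono_right h.left_subset
  · have := disjoint_faces_glued g.2
    rw [hga] at this
    exact this.mono_right h.right_subset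

/-- The intermediate stage has `a` already at its target and `b` still at its source. Disjointness
of the parts of `a` and `b` ensures that moving one leaves the other intact. -/
theorem compStage_succ {i j : ℕ} {b a : P.PreCell} {M : Set (P.Atom j)} (hij : i ≤ j)
    (hb : IsCell b) (ha : IsCell a) (h : CompStage i b a j M) :
    CompStage i b a (j + 1) (a.part true (j + 1) ∪ b.part false (j + 1)) := by
  have hf := hP.compStage_facts hij hb ha h
  have h1 := (hf false).2.1 false
  have h2 := (hf true).2.1 false
  rw [Set.disjoint_left] at h1 h2
  refine ⟨fun ε => (hf ε).1, Set.subset_union_left, Set.subset_union_right, ?_, ?_, ?_, ?_⟩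
  · intro S hS
    rw [PreCell.comp_part_of_gt (by omega), hS.1]
    exact Set.sdiff_subset.trans Set.subset_union_left
  · intro S hS
    rw [PreCell.comp_part_of_gt (by omega), glued, hS.1, hS.2]
    ext z
    have := @h1 z
    have := @h2 z
    simp only [Set.mem_union, Set.mem_sdiff]
    tauto
  · intro S hS
    rw [hS.1]
    exact Set.sdiff_subset.trans Set.subset_union_right
  · intro S hS
    rw [PreCell.comp_part_of_gt (by omega), glued, hS.1, hS.2]
    ext z
    have := @h1 z
    have := @h2 z
    simp only [Set.mem_union, Set.mem_sdiff]
    tauto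

theorem exists_compStage {i : ℕ} {b a : P.PreCell} (hb : IsCell b) (ha : IsCell a)
    (h : a.bd true i = b.bd false i) {j : ℕ} (hij : i ≤ j) : ∃ M, CompStage i b a j M := by
  induction j, hij using Nat.le_induction with
  | base => exact ⟨_, compStage_self hb ha h⟩
  | succ j hij ih => exact ⟨_, hP.compStage_succ hij hb ha ih.choose_spec⟩

theorem compClosed : P.CompClosed := by
  intro i b a hb ha h
  have h1 := (PreCell.part_eq_of_bd_eq h).1
  have key : ∀ ε j, IsTop (PreCell.comp i b a).part j ((PreCell.comp i b a).part ε j) := by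
    intro ε j
    rcases lt_or_ge j i with hj | hj
    · rw [PreCell.comp_part_of_lt hj]
      exact isTop_congr (fun ε k hk => (PreCell.comp_part_of_lt (hk.trans hj) ε b a).symm)
        (isTop_of_isCell ha ε j)
    · obtain ⟨M, hM⟩ := hP.exists_compStage hb ha h hj
      exact hM.isTop ε
  exact ⟨fun ε j => (key ε j).finite, fun ε j => (key ε j).forkFree,
    fun ε j => (key ε (j + 1)).2.2.1⟩

/-! ### Hypercancellativity of `FP`. -/

/-- A cell moves its source to its target without touching the target again. -/
theorem disjoint_faces_true {a : P.PreCell} (ha : IsCell a) (ε : Bool) (j : ℕ) :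
    Disjoint (P.faces true (a.part ε (j + 1))) (a.part false j) := by
  have hm := ha.moves ε j
  exact (hP.isTop_glued (hP.atomGluing j) (isTop_of_isCell ha false j) (ha.finite ε (j + 1))
    (ha.forkFree ε (j + 1)) (hm.1 ▸ Set.sdiff_subset)).2

/-- Fork-free sets of atoms are determined, within a composite, by what they move. -/
theorem subset_of_moves {n : ℕ} {S a a' b' : Set (P.Atom (n + 1))} {X Y : Set (P.Atom n)}
    (hS : P.ForkFree S) (ha : a.Finite) (haS : a ⊆ S) (haS' : a' ⊆ S) (hSab : S ⊆ a' ∪ b')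
    (hm : P.Moves a X Y) (hm' : P.Moves a' X Y) (hX : Disjoint (P.faces true a) X)
    (hY : Disjoint (P.faces true b') Y) : a ⊆ a' := by
  by_contra hne
  -- The fate of an element `z` of `x⁺` is followed: either `a` consumes it again or it survives in
  -- `Y`.
  obtain ⟨x, ⟨hx, hx'⟩, hmax⟩ := hP.exists_maximal (ha.subset (Set.sdiff_subset (t := a')))
    (Set.sdiff_nonempty.2 hne)
  obtain ⟨z, hz⟩ := hP.nonempty true n x
  have hxb : x ∈ b' := (hSab (haS hx)).resolve_left hx'
  by_cases hza : z ∈ P.faces false a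
  · obtain ⟨y, hy, hzy⟩ := hza
    have hy' : y ∈ a' := by
      by_contra h
      exact hmax y ⟨hy, h⟩ (.single ⟨z, hz, hzy⟩)
    -- By maximality of `x` the consumer `y` is in `a'`; by fork-freeness `x`, which is not in `a'`,
    -- is the only producer of `z` in `S`. So `z` is in `X`, although `a` produces it.
    have hzb : z ∈ P.border false a' := by
      refine ⟨⟨y, hy', hzy⟩, ?_⟩
      rintro ⟨w, hw, hzw⟩
      exact hx' (hS.eq (haS hx) (haS' hw) hz hzw ▸ hw)
    rw [hm'.1] at hzb
    exact Set.disjoint_left.1 hX ⟨x, hx, hz⟩ hzb.1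
  -- Here `z` is in `Y`, but `x` is in `b'`, whose targets avoid `Y`.
  · have hzb : z ∈ P.border true a := ⟨⟨x, hx, hz⟩, hza⟩
    rw [hm.2] at hzb
    exact Set.disjoint_left.1 hY ⟨x, hxb, hz⟩ hzb.1

/-- Below `i` the composite shows all parts; in dimension `i` it hides only the common boundary,
which `haa` supplies. Above, equality one dimension down makes the parts of `a` and `a'` perform the
same move. -/
theorem part_eq_of_comp_eq {i : ℕ} {a b a' b' : P.PreCell} (ha : IsCell a) (hb : IsCell b)
    (ha' : IsCell a') (hb' : IsCell b') (h : a.bd true i = b.bd false i)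
    (h' : a'.bd true i = b'.bd false i) (haa : a.bd true i = a'.bd true i)
    (hc : PreCell.comp i b a = PreCell.comp i b' a') (j : ℕ) (ε : Bool) :
    a.part ε j = a'.part ε j ∧ b.part ε j = b'.part ε j := by
  have hcp : ∀ ε j, (PreCell.comp i b a).part ε j = (PreCell.comp i b' a').part ε j :=
    fun ε j => by rw [hc]
  have e1 := PreCell.part_eq_of_bd_eq h
  have e2 := PreCell.part_eq_of_bd_eq h'
  rcases lt_or_ge j i with hj | hj
  · have := hcp ε j
    rw [PreCell.comp_part_of_lt hj, PreCell.comp_part_of_lt hj] at this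
    exact ⟨this, by rw [← e1.1 _ _ hj, ← e2.1 _ _ hj, this]⟩
  induction j, hj using Nat.le_induction generalizing ε with
  | base =>
    have e3 : a.part true i = a'.part true i := by
      have := congrFun (congrFun (congrArg PreCell.part haa) true) i
      simpa [PreCell.part_bd] using this
    have e4 := hcp false i
    have e5 := hcp true i
    rw [PreCell.comp_part_false, PreCell.comp_part_false] at e4
    rw [PreCell.comp_part_true, PreCell.comp_part_true] at e5
    cases ε
    · exact ⟨e4, by rw [← e1.2, ← e2.2, e3]⟩
    · exact ⟨e3, e5⟩
  | succ j hj ih =>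
    have hf := hP.compStage_facts hj hb ha (hP.exists_compStage hb ha h hj).choose_spec ε
    have hf' := hP.compStage_facts hj hb' ha' (hP.exists_compStage hb' ha' h' hj).choose_spec ε
    have hS := hcp ε (j + 1)
    rw [PreCell.comp_part_of_gt (by omega), PreCell.comp_part_of_gt (by omega)] at hS
    have hSf := hf.1.forkFree
    rw [PreCell.comp_part_of_gt (by omega)] at hSf
    have i1 := (ih false).1
    have i2 := (ih true).1
    have m1 := ha.moves ε j
    have m2 := ha'.moves ε j
    rw [← i1, ← i2] at m2
    have s1 := hP.disjoint_faces_true ha ε j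
    have s2 := hP.disjoint_faces_true ha' ε j
    have haa' : a.part ε (j + 1) = a'.part ε (j + 1) := by
      refine Set.Subset.antisymm ?_ ?_
      · exact hP.subset_of_moves hSf (ha.finite _ _) Set.subset_union_left
          (hS ▸ Set.subset_union_left) hS.subset m1 m2 s1 (i2 ▸ hf'.2.2.1)
      · exact hP.subset_of_moves hSf (ha'.finite _ _) (hS ▸ Set.subset_union_left)
          Set.subset_union_left subset_rfl m2 m1 (i1 ▸ s2) hf.2.2.1
    refine ⟨haa', ?_⟩
    have d1 := hf.2.1 ε
    have d2 := hf'.2.1 ε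
    rw [haa'] at hS d1
    -- The part of `b` is the complement of that of `a` in the composite.
    rw [← d1.sup_sdiff_cancel_left, ← d2.sup_sdiff_cancel_left]
    exact congrArg (· \ _) hS

theorem isHypercancellative : (P.cells hP.compClosed).IsHypercancellative := by
  intro i a b a' b' h h' haa hc
  have := hP.part_eq_of_comp_eq a.2 b.2 a'.2 b'.2 (congrArg Subtype.val h)
    (congrArg Subtype.val h') (congrArg Subtype.val haa) (congrArg Subtype.val hc)
  refine ⟨Subtype.ext ?_, Subtype.ext ?_⟩
  · ext ε j : 3
    exact (this j ε).1
  · ext ε j : 3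
    exact (this j ε).2

end IsTorsionFree
end OmegaHypergraph

/-! ### Absence of directed cycles in `FP`. -/

namespace StrictOmegaCat

/-- There are no directed cycles of `k`-cells: two cells of opposite `k`-boundaries are identities
on `k`-cells. -/
def IsLoopFree (A : StrictOmegaCat.{u}) : Prop :=
  ∀ (k : ℕ) (x y : A.Cell), A.bd true k x = A.bd false k y → A.bd true k y = A.bd false k x →
    A.bd false k x = x

end StrictOmegaCat

namespace OmegaHypergraph.IsTorsionFree

variable {P : OmegaHypergraph.{u}} (hP : P.IsTorsionFree)
include hP

/-- The `k`-source and `k`-target parts of `y ∘_k x` coincide, so its parts in dimension `k + 1`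
have empty source border and are empty. The emptiness of the parts of `x` then propagates upwards.
-/
theorem isLoopFree : (P.cells hP.compClosed).IsLoopFree := by
  rintro k ⟨x, hx⟩ ⟨y, hy⟩ h h'
  replace h : x.bd true k = y.bd false k := congrArg Subtype.val h
  replace h' : y.bd true k = x.bd false k := congrArg Subtype.val h'
  have he := hP.compClosed k y x hy hx h
  have hempty : ∀ j, k < j → ∀ ε, x.part ε j = ∅ := by
    intro j hj
    induction j, hj using Nat.le_induction with
    | base =>
      intro ε
      have h1 := (he.moves ε k).1
      rw [PreCell.comp_part_false, PreCell.comp_part_true, (PreCell.part_eq_of_bd_eq h').2,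
        sdiff_self] at h1
      have h2 := hP.eq_empty_of_border (he.finite ε (k + 1)) h1
      rw [PreCell.comp_part_of_gt (by omega)] at h2
      exact (Set.union_empty_iff.1 h2).1
    | succ j hj ih =>
      intro ε
      have h1 := (hx.moves ε j).1
      rw [ih false, Set.empty_sdiff] at h1
      exact hP.eq_empty_of_border (hx.finite ε _) h1
  -- The empty set moves `x_{-k}` to `x_k`, so these are equal.
  have hk := (hx.moves false k).glued_eq
  rw [hempty (k + 1) (by omega), (moves_empty _).glued_eq] at hk
  refine Subtype.ext ?_
  change x.bd false k = x
  ext ε j : 3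
  rw [PreCell.part_bd]
  split_ifs with h1 h2
  · rfl
  · subst h2
    cases ε
    exacts [rfl, hk]
  · rw [hempty j (by omega)]

end OmegaHypergraph.IsTorsionFree

namespace StrictOmegaCat

/-! ### Identities and boundaries in one-sorted ω-categories. -/

section Basic

variable {A B D : StrictOmegaCat.{u}}

theorem hom_ext {F G : A ⟶ B} (h : ∀ x, F.toFun x = G.toFun x) : F = G :=
  Hom.ext (funext h)

theorem toFun_comp (F : A ⟶ B) (G : B ⟶ D) (x : A.Cell) :
    (F ≫ G).toFun x = G.toFun (F.toFun x) := rfl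

/-- A cell of dimension at most `i` is its own boundary in all dimensions above. -/
theorem bd_eq_of_le {x : A.Cell} {ε : Bool} {i j : ℕ} (h : A.bd ε i x = x) (hij : i ≤ j)
    (δ : Bool) : A.bd δ j x = x := by
  rw [← h, A.bd_bd_of_le _ _ _ _ _ hij]

theorem comp_of_right_dim {i : ℕ} {x y : A.Cell} (h : A.bd true i y = A.bd false i x)
    (hy : A.bd true i y = y) : A.comp i x y h = x := by
  obtain rfl : y = A.bd false i x := hy.symm.trans h
  exact A.comp_id i x h

theorem comp_of_left_dim {i : ℕ} {x y : A.Cell} (h : A.bd true i y = A.bd false i x)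
    (hx : A.bd false i x = x) : A.comp i x y h = y := by
  obtain rfl : x = A.bd true i y := (h.trans hx).symm
  exact A.id_comp i y h

theorem comp_congr {i : ℕ} {x y x' y' : A.Cell} (h : A.bd true i y = A.bd false i x)
    (hx : x = x') (hy : y = y') (h' : A.bd true i y' = A.bd false i x') :
    A.comp i x y h = A.comp i x' y' h' := by
  subst hx hy
  rfl

theorem comp_cell_eq {i : ℕ} {x y : A.Cell} (F : A ⟶ B) (h : A.bd true i x = A.bd false i y) :
    B.bd true i (F.toFun x) = B.bd false i (F.toFun y) := by
  rw [← F.map_bd, ← F.map_bd, h]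

theorem map_comp' {i : ℕ} {x y : A.Cell} (F : A ⟶ B) (h : A.bd true i x = A.bd false i y) :
    F.toFun (A.comp i y x h) = B.comp i (F.toFun y) (F.toFun x) (comp_cell_eq F h) :=
  F.map_comp _ _ _ _ _

theorem IsSink.bd {a : A.Cell} (ha : A.IsSink a) (ε : Bool) (i : ℕ) : A.bd ε i a = a :=
  bd_eq_of_le ha.1 (Nat.zero_le i) ε

theorem IsSource.bd {a : A.Cell} (ha : A.IsSource a) (ε : Bool) (i : ℕ) : A.bd ε i a = a :=
  bd_eq_of_le ha.1 (Nat.zero_le i) ε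

theorem bd_zero_bd (ε δ : Bool) (i : ℕ) (x : A.Cell) (h : 0 < i) :
    A.bd ε 0 (A.bd δ i x) = A.bd ε 0 x := A.bd_bd_of_lt _ _ _ _ _ h

theorem bd_zero_comp (ε : Bool) {i : ℕ} (hi : 0 < i) {x y : A.Cell}
    (h : A.bd true i y = A.bd false i x) :
    A.bd ε 0 (A.comp i x y h) = A.bd ε 0 y ∧ A.bd ε 0 (A.comp i x y h) = A.bd ε 0 x := by
  constructor
  · rw [← bd_zero_bd ε false i _ hi, A.bd_false_comp, bd_zero_bd _ _ _ _ hi]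
  · rw [← bd_zero_bd ε true i _ hi, A.bd_true_comp, bd_zero_bd _ _ _ _ hi]

theorem bd_zero_eq {ε : Bool} {i : ℕ} (hi : 0 < i) {x y : A.Cell}
    (h : A.bd true i y = A.bd false i x) : A.bd ε 0 y = A.bd ε 0 x := by
  rw [← bd_zero_bd ε true i y hi, h, bd_zero_bd _ _ _ _ hi]

/-- A cell with an `i`-dimensional boundary of dimension `0` at a sink is the sink. -/
theorem IsSink.eq_of_bd {a : A.Cell} (ha : A.IsSink a) {ε : Bool} {i : ℕ} (hi : 0 < i) {x : A.Cell}
    (h : A.bd ε i x = a) : x = a :=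
  ha.2 x (by rw [← bd_zero_bd false ε i x hi, h, ha.1])

theorem IsSource.eq_of_bd {a : A.Cell} (ha : A.IsSource a) {ε : Bool} {i : ℕ} (hi : 0 < i)
    {x : A.Cell} (h : A.bd ε i x = a) : x = a :=
  ha.2 x (by rw [← bd_zero_bd true ε i x hi, h, ha.1])

end Basic

/-! ### Wedge sums, realised in the product by recording the two collapses onto the summands. -/

section Wedge

variable {A B : StrictOmegaCat.{u}} {a : A.Cell} {b : B.Cell}

/-- The cells of `A × B` which lie in the wedge sum gluing `a` to `b`. -/
def InWedge (A B : StrictOmegaCat.{u}) (a : A.Cell) (b : B.Cell) (x : A.Cell) (y : B.Cell) : Prop :=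
  y = b ∨ x = a ∨ (A.bd true 0 x = a ∧ B.bd false 0 y = b)

theorem InWedge.bd (ha : A.IsSink a) (hb : B.IsSource b) (ε : Bool) (i : ℕ) {x : A.Cell}
    {y : B.Cell} (h : InWedge A B a b x y) : InWedge A B a b (A.bd ε i x) (B.bd ε i y) := by
  rcases h with rfl | rfl | ⟨h1, h2⟩
  · exact Or.inl (hb.bd _ _)
  · exact Or.inr (Or.inl (ha.bd _ _))
  · rcases Nat.eq_zero_or_pos i with rfl | hi
    · cases ε
      exacts [Or.inl h2, Or.inr (Or.inl h1)]
    · exact Or.inr (Or.inr ⟨by rw [bd_zero_bd _ _ _ _ hi, h1], by rw [bd_zero_bd _ _ _ _ hi, h2]⟩)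

/-- Composable cells of a wedge sum: either both lie in the same summand, or the first one ends and
the second one starts in the glued point, or both cross this point. -/
theorem InWedge.composable (ha : A.IsSink a) (hb : B.IsSource b) {i : ℕ} {x x' : A.Cell}
    {y y' : B.Cell} (h : InWedge A B a b x y) (h' : InWedge A B a b x' y')
    (hx : A.bd true i x = A.bd false i x') (hy : B.bd true i y = B.bd false i y') :
    (y = b ∧ y' = b) ∨ (x = a ∧ x' = a) ∨
      (i = 0 ∧ A.bd true 0 x' = a ∧ B.bd false 0 y = b ∧ (y = b ∨ x' = a)) ∨
      (0 < i ∧ A.bd true 0 x = a ∧ B.bd false 0 y = b ∧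
        A.bd true 0 x' = a ∧ B.bd false 0 y' = b) := by
  have a1 := ha.bd
  have b1 := hb.bd
  have e1 : x = a → x' = a := by
    rintro rfl
    rcases Nat.eq_zero_or_pos i with rfl | hi
    · exact ha.2 _ (by rw [← hx, a1])
    · exact ha.eq_of_bd hi (hx.symm.trans (a1 _ _))
  have e2 : y' = b → y = b := by
    rintro rfl
    rcases Nat.eq_zero_or_pos i with rfl | hi
    · exact hb.2 _ (by rw [hy, b1])
    · exact hb.eq_of_bd hi (hy.trans (b1 _ _))
  have e3 : 0 < i → x' = a → x = a := by
    rintro hi rfl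
    exact ha.eq_of_bd hi (hx.trans (a1 _ _))
  have e4 : 0 < i → y = b → y' = b := by
    rintro hi rfl
    exact hb.eq_of_bd hi (hy.symm.trans (b1 _ _))
  rcases Nat.eq_zero_or_pos i with rfl | hi
  · rcases h with h | h | ⟨h1, h2⟩
    · rcases h' with h' | h' | ⟨h1', h2'⟩
      · exact Or.inl ⟨h, h'⟩
      · exact Or.inr (Or.inr (Or.inl ⟨rfl, by rw [h', a1], by rw [h, b1], Or.inl h⟩))
      · exact Or.inr (Or.inr (Or.inl ⟨rfl, h1', by rw [h, b1], Or.inl h⟩))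
    · exact Or.inr (Or.inl ⟨h, e1 h⟩)
    · have : x' = a := ha.2 _ (by rw [← hx, h1])
      exact Or.inr (Or.inr (Or.inl ⟨rfl, by rw [this, a1], h2, Or.inr this⟩))
  · rcases h with h | h | ⟨h1, h2⟩
    · exact Or.inl ⟨h, e4 hi h⟩
    · exact Or.inr (Or.inl ⟨h, e1 h⟩)
    · refine Or.inr (Or.inr (Or.inr ⟨hi, h1, h2, ?_, ?_⟩))
      · rw [← bd_zero_eq hi hx, h1]
      · rw [← bd_zero_eq hi hy, h2]

theorem InWedge.comp (ha : A.IsSink a) (hb : B.IsSource b) {i : ℕ} {x x' : A.Cell}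
    {y y' : B.Cell} (h : InWedge A B a b x y) (h' : InWedge A B a b x' y')
    (hx : A.bd true i x = A.bd false i x') (hy : B.bd true i y = B.bd false i y') :
    InWedge A B a b (A.comp i x' x hx) (B.comp i y' y hy) := by
  rcases InWedge.composable ha hb h h' hx hy with
    ⟨rfl, rfl⟩ | ⟨rfl, rfl⟩ | ⟨rfl, h1, h2, -⟩ | ⟨hi, h1, h2, h3, h4⟩
  · exact Or.inl (comp_of_left_dim _ (hb.bd _ _))
  · exact Or.inr (Or.inl (comp_of_left_dim _ (ha.bd _ _)))
  · exact Or.inr (Or.inr ⟨by rw [A.bd_true_comp, h1], by rw [B.bd_false_comp, h2]⟩)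
  · exact Or.inr (Or.inr ⟨by rw [(bd_zero_comp _ hi _).1, h1], by rw [(bd_zero_comp _ hi _).1, h2]⟩)

variable (A B a b) in
/-- The wedge sum of `A` and `B` gluing the sink `a` to the source `b`, embedded in `A × B`. -/
def wedge (ha : A.IsSink a) (hb : B.IsSource b) : StrictOmegaCat.{u} where
  Cell := {p : A.Cell × B.Cell // InWedge A B a b p.1 p.2}
  bd ε i p := ⟨(A.bd ε i p.1.1, B.bd ε i p.1.2), p.2.bd ha hb ε i⟩
  comp i q p h := ⟨(A.comp i q.1.1 p.1.1 (congrArg (fun z => z.1.1) h),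
    B.comp i q.1.2 p.1.2 (congrArg (fun z => z.1.2) h)), p.2.comp ha hb q.2 _ _⟩
  bd_bd_of_lt ε δ i j x hij :=
    Subtype.ext (Prod.ext (A.bd_bd_of_lt _ _ _ _ _ hij) (B.bd_bd_of_lt _ _ _ _ _ hij))
  bd_bd_of_le ε δ i j x hij :=
    Subtype.ext (Prod.ext (A.bd_bd_of_le _ _ _ _ _ hij) (B.bd_bd_of_le _ _ _ _ _ hij))
  exists_dim x := by
    obtain ⟨m, hm⟩ := A.exists_dim x.1.1
    obtain ⟨n, hn⟩ := B.exists_dim x.1.2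
    exact ⟨m + n, Subtype.ext (Prod.ext (bd_eq_of_le hm (by omega) _)
      (bd_eq_of_le hn (by omega) _))⟩
  bd_false_comp i b a h := Subtype.ext (Prod.ext (A.bd_false_comp _ _ _ _) (B.bd_false_comp _ _ _ _))
  bd_true_comp i b a h := Subtype.ext (Prod.ext (A.bd_true_comp _ _ _ _) (B.bd_true_comp _ _ _ _))
  bd_comp_of_lt ε i j b a h h' hij := Subtype.ext
    (Prod.ext (A.bd_comp_of_lt _ _ _ _ _ _ _ hij) (B.bd_comp_of_lt _ _ _ _ _ _ _ hij))
  comp_id i x h := Subtype.ext (Prod.ext (A.comp_id _ _ _) (B.comp_id _ _ _))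
  id_comp i x h := Subtype.ext (Prod.ext (A.id_comp _ _ _) (B.id_comp _ _ _))
  assoc i c b a hab hbc h h' := Subtype.ext
    (Prod.ext (A.assoc _ _ _ _ _ _ _ _) (B.assoc _ _ _ _ _ _ _ _))
  interchange i j a b c d hij hab hcd hac hbd h h' := Subtype.ext
    (Prod.ext (A.interchange _ _ _ _ _ _ hij _ _ _ _ _ _)
      (B.interchange _ _ _ _ _ _ hij _ _ _ _ _ _))

variable (ha : A.IsSink a) (hb : B.IsSource b)

/-- The inclusion of the left summand of a wedge sum. -/
def wedgeInl : A ⟶ wedge A B a b ha hb where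
  toFun x := ⟨(x, b), Or.inl rfl⟩
  map_bd _ _ _ := Subtype.ext (Prod.ext rfl (hb.bd _ _).symm)
  map_comp _ _ _ _ _ := Subtype.ext (Prod.ext rfl (comp_of_left_dim _ (hb.bd _ _)).symm)

/-- The inclusion of the right summand of a wedge sum. -/
def wedgeInr : B ⟶ wedge A B a b ha hb where
  toFun y := ⟨(a, y), Or.inr (Or.inl rfl)⟩
  map_bd _ _ _ := Subtype.ext (Prod.ext (ha.bd _ _).symm rfl)
  map_comp _ _ _ _ _ := Subtype.ext (Prod.ext (comp_of_left_dim _ (ha.bd _ _)).symm rfl)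

theorem wedgeInl_eq_wedgeInr :
    (wedgeInl ha hb).toFun a = (wedgeInr ha hb).toFun b := rfl

theorem wedge_composable {x : A.Cell} {y : B.Cell} (hx : A.bd true 0 x = a)
    (hy : B.bd false 0 y = b) :
    (wedge A B a b ha hb).bd true 0 ((wedgeInl ha hb).toFun x) =
      (wedge A B a b ha hb).bd false 0 ((wedgeInr ha hb).toFun y) := by
  rw [← (wedgeInl ha hb).map_bd, ← (wedgeInr ha hb).map_bd, hx, hy, wedgeInl_eq_wedgeInr]

/-- A cell crossing the glued point is the composite of its two projections, so the summands
generate the wedge sum. -/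
theorem wedge_comp {x : A.Cell} {y : B.Cell} (hx : A.bd true 0 x = a) (hy : B.bd false 0 y = b) :
    (wedge A B a b ha hb).comp 0 ((wedgeInr ha hb).toFun y) ((wedgeInl ha hb).toFun x)
      (wedge_composable ha hb hx hy) = ⟨(x, y), Or.inr (Or.inr ⟨hx, hy⟩)⟩ :=
  Subtype.ext (Prod.ext (comp_of_left_dim _ (ha.bd _ _)) (comp_of_right_dim _ (hb.bd _ _)))

variable {ha hb} in
theorem wedge_cases {motive : (wedge A B a b ha hb).Cell → Prop}
    (left : ∀ x, motive ((wedgeInl ha hb).toFun x))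
    (right : ∀ y, motive ((wedgeInr ha hb).toFun y))
    (comp : ∀ x y (hx : A.bd true 0 x = a) (hy : B.bd false 0 y = b),
      motive ((wedge A B a b ha hb).comp 0 ((wedgeInr ha hb).toFun y) ((wedgeInl ha hb).toFun x)
        (wedge_composable ha hb hx hy))) (p) : motive p := by
  obtain ⟨⟨x, y⟩, h⟩ := p
  have h' := h
  rcases h' with h' | h' | ⟨h1, h2⟩
  · change y = b at h'
    subst h'
    exact left x
  · change x = a at h'
    subst h'
    exact right y
  · exact wedge_comp ha hb h1 h2 ▸ comp x y h1 h2

variable {ha hb} in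
theorem wedge_hom_ext {D : StrictOmegaCat.{u}} {F G : wedge A B a b ha hb ⟶ D}
    (hl : wedgeInl ha hb ≫ F = wedgeInl ha hb ≫ G)
    (hr : wedgeInr ha hb ≫ F = wedgeInr ha hb ≫ G) : F = G := by
  have hl' : ∀ x, F.toFun ((wedgeInl ha hb).toFun x) = G.toFun ((wedgeInl ha hb).toFun x) :=
    fun x => congrFun (congrArg Hom.toFun hl) x
  have hr' : ∀ x, F.toFun ((wedgeInr ha hb).toFun x) = G.toFun ((wedgeInr ha hb).toFun x) :=
    fun x => congrFun (congrArg Hom.toFun hr) x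
  refine hom_ext fun p => ?_
  refine wedge_cases (motive := fun p => F.toFun p = G.toFun p) hl' hr' (fun x y hx hy => ?_) p
  rw [map_comp', map_comp']
  exact comp_congr _ (hr' y) (hl' x) _

variable {D : StrictOmegaCat.{u}} (F : A ⟶ D) (G : B ⟶ D) (hFG : F.toFun a = G.toFun b)

include hFG in
theorem desc_composable {x : A.Cell} {y : B.Cell} (hx : A.bd true 0 x = a)
    (hy : B.bd false 0 y = b) : D.bd true 0 (F.toFun x) = D.bd false 0 (G.toFun y) := by
  rw [← F.map_bd, ← G.map_bd, hx, hy, hFG]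

open Classical in
/-- The underlying function of the map out of a wedge sum. -/
noncomputable def wedgeDescFun (p : (wedge A B a b ha hb).Cell) : D.Cell :=
  if hy : p.1.2 = b then F.toFun p.1.1
  else if hx : p.1.1 = a then G.toFun p.1.2
  else D.comp 0 (G.toFun p.1.2) (F.toFun p.1.1)
    (desc_composable F G hFG ((p.2.resolve_left hy).resolve_left hx).1
      ((p.2.resolve_left hy).resolve_left hx).2)

theorem wedgeDescFun_left (x : A.Cell) (y : B.Cell) (h : InWedge A B a b x y) (hy : y = b) :
    wedgeDescFun ha hb F G hFG ⟨(x, y), h⟩ = F.toFun x := dif_pos hy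

theorem wedgeDescFun_right (x : A.Cell) (y : B.Cell) (h : InWedge A B a b x y) (hx : x = a) :
    wedgeDescFun ha hb F G hFG ⟨(x, y), h⟩ = G.toFun y := by
  by_cases hy : y = b
  · refine (wedgeDescFun_left ha hb F G hFG x y h hy).trans ?_
    rw [hx, hy, hFG]
  · exact (dif_neg hy).trans (dif_pos hx)

/-- The composite formula persists when a factor is the glued point, its image being an identity.
Functoriality can thus be checked without the case split of `wedgeDescFun`. -/
theorem wedgeDescFun_comp (x : A.Cell) (y : B.Cell) (h : InWedge A B a b x y)
    (hx : A.bd true 0 x = a) (hy : B.bd false 0 y = b) :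
    wedgeDescFun ha hb F G hFG ⟨(x, y), h⟩ =
      D.comp 0 (G.toFun y) (F.toFun x) (desc_composable F G hFG hx hy) := by
  by_cases hy' : y = b
  · refine (wedgeDescFun_left ha hb F G hFG x y h hy').trans (comp_of_left_dim _ ?_).symm
    rw [← G.map_bd, hy, hy']
  · by_cases hx' : x = a
    · refine (wedgeDescFun_right ha hb F G hFG x y h hx').trans (comp_of_right_dim _ ?_).symm
      rw [← F.map_bd, hx, hx']
    · exact (dif_neg hy').trans (dif_neg hx')

/-- The map out of a wedge sum induced by maps out of the summands. -/
noncomputable def wedgeDesc : wedge A B a b ha hb ⟶ D where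
  toFun := wedgeDescFun ha hb F G hFG
  map_bd ε i p := by
    obtain ⟨⟨x, y⟩, h⟩ := p
    have h' : InWedge A B a b x y := h
    rcases h' with h' | h' | ⟨h1, h2⟩
    · rw [wedgeDescFun_left _ _ _ _ _ x y h h', ← F.map_bd]
      exact wedgeDescFun_left _ _ _ _ _ _ _ _ ((congrArg _ h').trans (hb.bd _ _))
    · rw [wedgeDescFun_right _ _ _ _ _ x y h h', ← G.map_bd]
      exact wedgeDescFun_right _ _ _ _ _ _ _ _ ((congrArg _ h').trans (ha.bd _ _))
    · rw [wedgeDescFun_comp _ _ _ _ _ x y h h1 h2]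
      rcases Nat.eq_zero_or_pos i with rfl | hi
      · cases ε
        · rw [D.bd_false_comp, ← F.map_bd]
          exact wedgeDescFun_left _ _ _ _ _ _ _ _ h2
        · rw [D.bd_true_comp, ← G.map_bd]
          exact wedgeDescFun_right _ _ _ _ _ _ _ _ h1
      · have e1 : A.bd true 0 (A.bd ε i x) = a := by rw [bd_zero_bd _ _ _ _ hi, h1]
        have e2 : B.bd false 0 (B.bd ε i y) = b := by rw [bd_zero_bd _ _ _ _ hi, h2]
        have e3 := desc_composable F G hFG e1 e2
        rw [F.map_bd, G.map_bd] at e3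
        rw [D.bd_comp_of_lt _ _ _ _ _ _ e3 hi]
        refine (wedgeDescFun_comp _ _ _ _ _ _ _ _ e1 e2).trans ?_
        exact comp_congr _ (G.map_bd _ _ _) (F.map_bd _ _ _) _
  map_comp i q p h h' := by
    obtain ⟨⟨x, y⟩, hp⟩ := p
    obtain ⟨⟨x', y'⟩, hq⟩ := q
    have hx : A.bd true i x = A.bd false i x' := congrArg (fun z => z.1.1) h
    have hy : B.bd true i y = B.bd false i y' := congrArg (fun z => z.1.2) h
    change wedgeDescFun ha hb F G hFG ⟨(A.comp i x' x hx, B.comp i y' y hy), _⟩ = _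
    rcases InWedge.composable (x := x) (x' := x') (y := y) (y' := y') ha hb hp hq hx hy with
      ⟨h1, h2⟩ | ⟨h1, h2⟩ | ⟨rfl, h1, h2, h3⟩ | ⟨hi, h1, h2, h3, h4⟩
    · rw [wedgeDescFun_left, map_comp']
      · exact comp_congr _ (wedgeDescFun_left _ _ _ _ _ _ _ _ h2).symm
          (wedgeDescFun_left _ _ _ _ _ _ _ _ h1).symm _
      · subst h1
        rw [comp_of_right_dim _ (hb.bd _ _), h2]
    · rw [wedgeDescFun_right, map_comp']
      · exact comp_congr _ (wedgeDescFun_right _ _ _ _ _ _ _ _ h2).symm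
          (wedgeDescFun_right _ _ _ _ _ _ _ _ h1).symm _
      · subst h1
        rw [comp_of_right_dim _ (ha.bd _ _), h2]
    · have e1 : A.bd true 0 (A.comp 0 x' x hx) = a := by rw [A.bd_true_comp, h1]
      have e2 : B.bd false 0 (B.comp 0 y' y hy) = b := by rw [B.bd_false_comp, h2]
      rw [wedgeDescFun_comp _ _ _ _ _ _ _ _ e1 e2]
      -- One of the two cells stays in its summand, so only three factors occur and associativity
      -- suffices.
      rcases h3 with h3 | h3
      · have e3 : B.comp 0 y' y hy = y' := comp_of_right_dim _ (by rw [h3, hb.bd])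
        have e4 : B.bd false 0 y' = b := by rw [← hy, h3, hb.bd]
        have e5 : wedgeDescFun ha hb F G hFG ⟨(x, y), hp⟩ = F.toFun x :=
          wedgeDescFun_left _ _ _ _ _ _ _ _ h3
        have e6 := wedgeDescFun_comp ha hb F G hFG x' y' hq h1 e4
        have e7 := comp_cell_eq F hx
        have e8 := desc_composable F G hFG h1 e4
        refine Eq.trans ?_ (comp_congr ?_ e6.symm e5.symm _)
        · refine (comp_congr _ (congrArg G.toFun e3) (map_comp' F hx) ?_).trans ?_
          · rw [D.bd_true_comp, e8]
          · exact D.assoc _ _ _ _ e7 e8 _ (by rw [D.bd_false_comp, e7])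
      · have e3 : A.comp 0 x' x hx = x := comp_of_left_dim _ (by rw [h3, ha.bd])
        have e4 : A.bd true 0 x = a := by rw [hx, h3, ha.bd]
        have e5 : wedgeDescFun ha hb F G hFG ⟨(x', y'), hq⟩ = G.toFun y' :=
          wedgeDescFun_right _ _ _ _ _ _ _ _ h3
        have e6 := wedgeDescFun_comp ha hb F G hFG x y hp e4 h2
        have e7 := comp_cell_eq G hy
        have e8 := desc_composable F G hFG e4 h2
        refine Eq.trans ?_ (comp_congr ?_ e5.symm e6.symm _)
        · refine (comp_congr _ (map_comp' G hy) (congrArg F.toFun e3) ?_).trans ?_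
          · rw [D.bd_false_comp, e8]
          · exact (D.assoc _ _ _ _ e8 e7 (by rw [D.bd_true_comp, e7]) _).symm
    · have e1 : A.bd true 0 (A.comp i x' x hx) = a := by rw [(bd_zero_comp _ hi _).1, h1]
      have e2 : B.bd false 0 (B.comp i y' y hy) = b := by rw [(bd_zero_comp _ hi _).1, h2]
      have e3 := wedgeDescFun_comp ha hb F G hFG x y hp h1 h2
      have e4 := wedgeDescFun_comp ha hb F G hFG x' y' hq h3 h4
      have e5 := h'
      rw [e3, e4] at e5
      have e6 := desc_composable F G hFG e1 e2
      rw [map_comp', map_comp'] at e6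
      rw [wedgeDescFun_comp _ _ _ _ _ _ _ _ e1 e2]
      refine Eq.trans ?_ (comp_congr e5 e4.symm e3.symm _)
      refine (comp_congr _ (map_comp' G hy) (map_comp' F hx) e6).trans ?_
      exact D.interchange 0 i _ _ _ _ hi _ _ _ _ _ _

theorem wedgeInl_desc : wedgeInl ha hb ≫ wedgeDesc ha hb F G hFG = F :=
  hom_ext fun x => wedgeDescFun_left ha hb F G hFG x b _ rfl

theorem wedgeInr_desc : wedgeInr ha hb ≫ wedgeDesc ha hb F G hFG = G :=
  hom_ext fun y => wedgeDescFun_right ha hb F G hFG a y _ rfl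

theorem wedgeDesc_inl (x : A.Cell) :
    (wedgeDesc ha hb F G hFG).toFun ((wedgeInl ha hb).toFun x) = F.toFun x :=
  wedgeDescFun_left ha hb F G hFG x b _ rfl

theorem wedgeDesc_inr (y : B.Cell) :
    (wedgeDesc ha hb F G hFG).toFun ((wedgeInr ha hb).toFun y) = G.toFun y :=
  wedgeDescFun_right ha hb F G hFG a y _ rfl

end Wedge

/-! ### The wedge sum as a pushout over the terminal ω-category. -/

section Pushout

variable {A B : StrictOmegaCat.{u}} {a : A.Cell} {b : B.Cell}

/-- The terminal strict ω-category. -/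
def unit : StrictOmegaCat.{u} where
  Cell := PUnit
  bd _ _ x := x
  comp _ x _ _ := x
  bd_bd_of_lt _ _ _ _ _ _ := rfl
  bd_bd_of_le _ _ _ _ _ _ := rfl
  exists_dim _ := ⟨0, rfl⟩
  bd_false_comp _ _ _ _ := rfl
  bd_true_comp _ _ _ _ := rfl
  bd_comp_of_lt _ _ _ _ _ _ _ _ := rfl
  comp_id _ _ _ := rfl
  id_comp _ _ _ := rfl
  assoc _ _ _ _ _ _ _ _ := rfl
  interchange _ _ _ _ _ _ _ _ _ _ _ _ _ := rfl

/-- The constant map with value an object. -/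
def const (B : StrictOmegaCat.{u}) (a : A.Cell) (ha : A.bd false 0 a = a) : B ⟶ A where
  toFun _ := a
  map_bd _ _ _ := (bd_eq_of_le ha (Nat.zero_le _) _).symm
  map_comp _ _ _ _ _ := (comp_of_left_dim _ (bd_eq_of_le ha (Nat.zero_le _) _)).symm

/-- The one-cell ω-category is terminal. -/
def isTerminalUnit : IsTerminal unit.{u} :=
  IsTerminal.ofUniqueHom (fun B => const B PUnit.unit rfl) fun _ _ => hom_ext fun _ => rfl

theorem isPushout_wedge (ha : A.IsSink a) (hb : B.IsSource b) :
    IsPushout (const unit a (ha.bd _ _)) (const unit b (hb.bd _ _)) (wedgeInl ha hb)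
      (wedgeInr ha hb) := by
  have w : const unit.{u} a (ha.bd _ _) ≫ wedgeInl ha hb =
    const unit b (hb.bd _ _) ≫ wedgeInr ha hb := hom_ext fun _ => rfl
  have h (s : PushoutCocone (const unit.{u} a (ha.bd _ _)) (const unit b (hb.bd _ _))) :
      s.inl.toFun a = s.inr.toFun b :=
    congrFun (congrArg Hom.toFun s.condition) (PUnit.unit : unit.Cell)
  exact ⟨⟨w⟩, ⟨PushoutCocone.IsColimit.mk w (fun s => wedgeDesc ha hb s.inl s.inr (h s))
    (fun s => wedgeInl_desc ..) (fun s => wedgeInr_desc ..) fun s m h1 h2 => wedge_hom_ext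
      (h1.trans (wedgeInl_desc ..).symm) (h2.trans (wedgeInr_desc ..).symm)⟩⟩

end Pushout

end StrictOmegaCat

namespace StrictOmegaCat

/-! ### Suspensions and hom ω-categories. -/

section Susp

variable {A B D : StrictOmegaCat.{u}}

/-- The ω-category of cells with `0`-source `p` and `0`-target `q`. -/
def homCat (D : StrictOmegaCat.{u}) (p q : D.Cell) : StrictOmegaCat.{u} where
  Cell := {x : D.Cell // D.bd false 0 x = p ∧ D.bd true 0 x = q}
  bd ε i x := ⟨D.bd ε (i + 1) x.1, by
    rw [bd_zero_bd _ _ _ _ i.succ_pos, bd_zero_bd _ _ _ _ i.succ_pos]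
    exact x.2⟩
  comp i y x h := ⟨D.comp (i + 1) y.1 x.1 (congrArg Subtype.val h), by
    rw [(bd_zero_comp false i.succ_pos _).1, (bd_zero_comp true i.succ_pos _).1]
    exact x.2⟩
  bd_bd_of_lt _ _ _ _ _ hij := Subtype.ext (D.bd_bd_of_lt _ _ _ _ _ (by omega))
  bd_bd_of_le _ _ _ _ _ hij := Subtype.ext (D.bd_bd_of_le _ _ _ _ _ (by omega))
  exists_dim x := by
    obtain ⟨n, hn⟩ := D.exists_dim x.1
    exact ⟨n, Subtype.ext (bd_eq_of_le hn n.le_succ _)⟩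
  bd_false_comp _ _ _ _ := Subtype.ext (D.bd_false_comp _ _ _ _)
  bd_true_comp _ _ _ _ := Subtype.ext (D.bd_true_comp _ _ _ _)
  bd_comp_of_lt _ _ _ _ _ _ _ hij := Subtype.ext (D.bd_comp_of_lt _ _ _ _ _ _ _ (by omega))
  comp_id _ _ _ := Subtype.ext (D.comp_id _ _ _)
  id_comp _ _ _ := Subtype.ext (D.id_comp _ _ _)
  assoc _ _ _ _ _ _ _ _ := Subtype.ext (D.assoc _ _ _ _ _ _ _ _)
  interchange _ _ _ _ _ _ hij _ _ _ _ _ _ :=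
    Subtype.ext (D.interchange _ _ _ _ _ _ (by omega) _ _ _ _ _ _)

/-- The objects of a suspension. -/
def suspObj (A : StrictOmegaCat.{u}) (p : Bool) : A.susp.Cell := .inl p

/-- The suspension of a cell. -/
def suspCell (x : A.Cell) : A.susp.Cell := .inr x

/-- The map out of a suspension with prescribed values on the two objects. -/
def suspLift {p q : D.Cell} (hp : D.bd false 0 p = p) (hq : D.bd false 0 q = q)
    (F : A ⟶ homCat D p q) : A.susp ⟶ D where
  toFun x := match x with
    | .inl false => p
    | .inl true => q
    | .inr x => (F.toFun x).1
  map_bd ε i x := by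
    have h1 := fun δ => (bd_eq_of_le hp (Nat.zero_le i) δ).symm
    have h2 := fun δ => (bd_eq_of_le hq (Nat.zero_le i) δ).symm
    rcases x with (_ | _) | x
    · exact h1 ε
    · exact h2 ε
    · rcases i with _ | i
      · cases ε
        exacts [(F.toFun x).2.1.symm, (F.toFun x).2.2.symm]
      · exact congrArg Subtype.val (F.map_bd ε i x)
  map_comp i y x h h' := by
    have h1 := fun δ => bd_eq_of_le hp (Nat.zero_le i) δ
    have h2 := fun δ => bd_eq_of_le hq (Nat.zero_le i) δ
    rcases y with (_ | _) | y
    · rcases x with (_ | _) | x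
      · exact (comp_of_left_dim _ (h1 _)).symm
      · cases i <;> cases h
      · exact (comp_of_left_dim _ (h1 _)).symm
    · rcases x with (_ | _) | x
      · cases i <;> cases h
      · exact (comp_of_left_dim _ (h2 _)).symm
      · exact (comp_of_left_dim _ (h2 _)).symm
    · rcases x with (_ | _) | x
      · cases i <;> exact (comp_of_right_dim _ (h1 _)).symm
      · cases i <;> exact (comp_of_right_dim _ (h2 _)).symm
      · rcases i with _ | i
        · cases h
        · exact congrArg Subtype.val (map_comp' F (Sum.inr.inj h))

/-- The map from `A` to an ω-category of homs induced by a map out of the suspension of `A`. -/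
def suspRestrict (F : A.susp ⟶ D) :
    A ⟶ homCat D (F.toFun (suspObj _ false)) (F.toFun (suspObj _ true)) where
  toFun x := ⟨F.toFun (suspCell x), (F.map_bd false 0 (suspCell x)).symm, (F.map_bd true 0 (suspCell x)).symm⟩
  map_bd ε i x := Subtype.ext (F.map_bd ε (i + 1) (suspCell x))
  map_comp i y x h _ := by
    have h1 : A.susp.bd true (i + 1) (suspCell x) =
      A.susp.bd false (i + 1) (suspCell y) := congrArg Sum.inr h
    exact Subtype.ext (map_comp' F h1)

/-- The suspension of a map. -/
def suspMap (F : A ⟶ B) : A.susp ⟶ B.susp where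
  toFun := Sum.map id F.toFun
  map_bd ε i x := by
    rcases x with p | x
    · rfl
    · rcases i with _ | i
      · rfl
      · exact congrArg Sum.inr (F.map_bd ε i x)
  map_comp i y x h h' := by
    rcases y with p | y <;> rcases x with q | x
    · rfl
    · rfl
    · cases i <;> rfl
    · rcases i with _ | i
      · rfl
      · exact congrArg Sum.inr (map_comp' F (Sum.inr.inj h))

theorem susp_hom_ext {F G : A.susp ⟶ D} (h : ∀ p, F.toFun (suspObj _ p) = G.toFun (suspObj _ p))
    (h' : ∀ x, F.toFun (suspCell x) = G.toFun (suspCell x)) : F = G :=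
  hom_ext fun x => match x with
    | .inl p => h p
    | .inr x => h' x

/-- Isomorphic ω-categories have isomorphic suspensions. -/
def suspIso (e : A ≅ B) : A.susp ≅ B.susp where
  hom := suspMap e.hom
  inv := suspMap e.inv
  hom_inv_id := susp_hom_ext (fun _ => rfl)
    fun x => congrArg Sum.inr (congrFun (congrArg Hom.toFun e.hom_inv_id) x)
  inv_hom_id := susp_hom_ext (fun _ => rfl)
    fun x => congrArg Sum.inr (congrFun (congrArg Hom.toFun e.inv_hom_id) x)

theorem isSink_susp (A : StrictOmegaCat.{u}) : A.susp.IsSink (suspObj _ true) := by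
  refine ⟨rfl, ?_⟩
  rintro (p | x) h
  · exact h
  · cases h

theorem isSource_susp (A : StrictOmegaCat.{u}) : A.susp.IsSource (suspObj _ false) := by
  refine ⟨rfl, ?_⟩
  rintro (p | x) h
  · exact h
  · cases h

/-- Postcomposition with a `1`-cell. -/
def postcomp {p q r : D.Cell} (w : D.Cell) (h0 : D.bd false 0 w = q) (h1 : D.bd true 0 w = r)
    (hw : D.bd false 1 w = w) : homCat D p q ⟶ homCat D p r where
  toFun x := ⟨D.comp 0 w x.1 (x.2.2.trans h0.symm), by
    rw [D.bd_false_comp, D.bd_true_comp]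
    exact ⟨x.2.1, h1⟩⟩
  map_bd ε i x := by
    have hw' := bd_eq_of_le hw (Nat.succ_le_succ (Nat.zero_le i)) ε
    have h : D.bd true 0 (D.bd ε (i + 1) x.1) = D.bd false 0 (D.bd ε (i + 1) w) := by
      rw [bd_zero_bd _ _ _ _ i.succ_pos, hw', h0, x.2.2]
    exact Subtype.ext ((D.bd_comp_of_lt ε 0 (i + 1) w x.1 (x.2.2.trans h0.symm) h
      i.succ_pos).trans (comp_congr _ hw' rfl _)).symm
  map_comp i y x h h' := by
    have hw' := fun δ => bd_eq_of_le hw (Nat.succ_le_succ (Nat.zero_le i)) δ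
    have h2 : D.bd true (i + 1) w = D.bd false (i + 1) w := by rw [hw', hw']
    have h3 : D.bd true (i + 1) x.1 = D.bd false (i + 1) y.1 := congrArg Subtype.val h
    -- Writing the `1`-cell `w` as a composite of identities on it makes interchange applicable.
    have h4 : D.comp (i + 1) w w h2 = w := comp_of_left_dim _ (hw' _)
    have h5 : D.bd true 0 (D.comp (i + 1) y.1 x.1 h3) = D.bd false 0 (D.comp (i + 1) w w h2) := by
      rw [h4, (bd_zero_comp _ i.succ_pos _).1, x.2.2, h0]
    refine Subtype.ext ?_
    refine (comp_congr _ h4.symm rfl h5).trans ?_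
    exact D.interchange 0 (i + 1) _ _ _ _ i.succ_pos _ _ _ _ _ _

/-- Structure in a hom ω-category is that of `D` shifted by one dimension. This inheritance lets the
induction on trees enter the first branch. -/
theorem IsLoopFree.homCat (hD : D.IsLoopFree) (p q : D.Cell) : (homCat D p q).IsLoopFree :=
  fun k x y h h' => Subtype.ext
    (hD (k + 1) x.1 y.1 (congrArg Subtype.val h) (congrArg Subtype.val h'))

theorem IsHypercancellative.homCat (hD : D.IsHypercancellative) (p q : D.Cell) :
    (homCat D p q).IsHypercancellative := by
  intro i a b a' b' h h' haa hc
  have := hD (i + 1) a.1 b.1 a'.1 b'.1 (congrArg Subtype.val h) (congrArg Subtype.val h')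
    (congrArg Subtype.val haa) (congrArg Subtype.val hc)
  exact ⟨Subtype.ext this.1, Subtype.ext this.2⟩

/-- The cycle is closed by the identity on the common boundary. -/
theorem IsLoopFree.eq_of_bd_eq (hD : D.IsLoopFree) {k : ℕ} {x : D.Cell}
    (h : D.bd true k x = D.bd false k x) : D.bd false k x = x := by
  refine hD k x (D.bd true k x) ?_ ?_
  · rw [D.bd_bd_of_le _ _ _ _ _ le_rfl]
  · rw [D.bd_bd_of_le _ _ _ _ _ le_rfl, h]

end Susp

/-! ### Planar trees and the objects of `Θ`. -/

section Tree

/-- An ω-category with a sink and a source. -/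
structure Bipointed where
  cat : StrictOmegaCat.{u}
  src : cat.Cell
  tgt : cat.Cell
  isSource : cat.IsSource src
  isSink : cat.IsSink tgt

theorem IsSink.wedge {A B : StrictOmegaCat.{u}} {a : A.Cell} {b t : B.Cell} (ha : A.IsSink a)
    (hb : B.IsSource b) (ht : B.IsSink t) :
    (wedge A B a b ha hb).IsSink ((wedgeInr ha hb).toFun t) := by
  refine ⟨by rw [← Hom.map_bd, ht.bd], fun x hx => Subtype.ext (Prod.ext ?_ ?_)⟩
  · exact ha.2 _ (congrArg (fun z => z.1.1) hx)
  · exact ht.2 _ (congrArg (fun z => z.1.2) hx)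

theorem IsSource.wedge {A B : StrictOmegaCat.{u}} {a s : A.Cell} {b : B.Cell} (ha : A.IsSink a)
    (hb : B.IsSource b) (hs : A.IsSource s) :
    (wedge A B a b ha hb).IsSource ((wedgeInl ha hb).toFun s) := by
  refine ⟨by rw [← Hom.map_bd, hs.bd], fun x hx => Subtype.ext (Prod.ext ?_ ?_)⟩
  · exact hs.2 _ (congrArg (fun z => z.1.1) hx)
  · exact hb.2 _ (congrArg (fun z => z.1.2) hx)

/-- Planar rooted trees: the tree `cons A B` has `A` as its first branch, and the remaining
branches form the tree `B`. -/
inductive Tree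
  | nil : Tree
  | cons (A B : Tree) : Tree

/-- The object of `Θ` given by a tree. -/
def Tree.real : Tree → Bipointed.{u}
  | .nil => ⟨unit, PUnit.unit, PUnit.unit, ⟨rfl, fun _ _ => rfl⟩, ⟨rfl, fun _ _ => rfl⟩⟩
  | .cons A B => ⟨wedge A.real.cat.susp B.real.cat (suspObj _ true) B.real.src (isSink_susp _)
      B.real.isSource, _, _, IsSource.wedge _ _ (isSource_susp _), IsSink.wedge _ _ B.real.isSink⟩

/-- The inclusion of the suspension of the first branch. -/
def Tree.inl (A B : Tree) : A.real.cat.susp ⟶ (cons A B).real.cat :=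
  wedgeInl (isSink_susp _) B.real.isSource

/-- The inclusion of the remaining branches. -/
def Tree.inr (A B : Tree) : B.real.cat ⟶ (cons A B).real.cat :=
  wedgeInr (isSink_susp _) B.real.isSource

/-- The map out of a tree with given restrictions. -/
noncomputable def Tree.desc {A B : Tree} {D : StrictOmegaCat.{u}} (F : A.real.cat.susp ⟶ D)
    (G : B.real.cat ⟶ D) (h : F.toFun (suspObj _ true) = G.toFun B.real.src) :
    (cons A B).real.cat ⟶ D :=
  wedgeDesc (isSink_susp _) B.real.isSource F G h

namespace Tree

variable {A B : Tree} {D : StrictOmegaCat.{u}}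

theorem src_cons : (cons A B).real.src = (inl.{u} A B).toFun (suspObj _ false) := rfl

theorem inl_true : (inl.{u} A B).toFun (suspObj _ true) = (inr A B).toFun B.real.src := rfl

theorem inl_desc (F : A.real.cat.susp ⟶ D) (G : B.real.cat ⟶ D) (h) :
    inl A B ≫ desc F G h = F := wedgeInl_desc ..

theorem inr_desc (F : A.real.cat.susp ⟶ D) (G : B.real.cat ⟶ D) (h) :
    inr A B ≫ desc F G h = G := wedgeInr_desc ..

theorem desc_inl (F : A.real.cat.susp ⟶ D) (G : B.real.cat ⟶ D) (h) (x) :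
    (desc F G h).toFun ((inl A B).toFun x) = F.toFun x := wedgeDesc_inl ..

theorem desc_inr (F : A.real.cat.susp ⟶ D) (G : B.real.cat ⟶ D) (h) (x) :
    (desc F G h).toFun ((inr A B).toFun x) = G.toFun x := wedgeDesc_inr ..

theorem real_hom_ext {F G : (cons A B).real.cat ⟶ D} (hl : inl A B ≫ F = inl A B ≫ G)
    (hr : inr A B ≫ F = inr A B ≫ G) : F = G := wedge_hom_ext hl hr

theorem inl_injective (A B : Tree) : Function.Injective (inl.{u} A B).toFun :=
  fun _ _ h => congrArg (fun z => z.1.1) h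

theorem inr_injective (A B : Tree) : Function.Injective (inr.{u} A B).toFun :=
  fun _ _ h => congrArg (fun z => z.1.2) h

theorem isPushout (A B : Tree) :
    IsPushout (const (A := A.real.cat.susp) unit (suspObj _ true) ((isSink_susp A.real.cat).bd _ _))
      (const unit B.real.src (B.real.isSource.bd _ _)) (inl.{u} A B) (inr A B) :=
  isPushout_wedge _ _

theorem isTheta : ∀ T : Tree, T.real.cat.IsTheta
  | .nil => .point _ ⟨isTerminalUnit⟩
  | .cons A B => .wedge _ _ _ _ ⟨isTerminalUnit⟩ (.susp _ _ A.isTheta ⟨Iso.refl _⟩) B.isTheta _ _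
      (fun _ => isSink_susp _) (fun _ => B.real.isSource) _ _ (isPushout A B)

/-- Cells of a tree which are not in a summand are composites. -/
theorem real_cases {motive : (cons A B).real.cat.Cell → Prop}
    (left : ∀ x, motive ((inl A B).toFun x)) (right : ∀ y, motive ((inr A B).toFun y))
    (comp : ∀ x y h, B.real.cat.bd false 0 y = B.real.src →
      motive ((cons A B).real.cat.comp 0 ((inr A B).toFun y) ((inl A B).toFun (suspCell x)) h)) (p) :
    motive p := by
  refine wedge_cases left right (fun x y hx hy => ?_) p
  rcases x with x | x
  · obtain rfl : x = true := Sum.inl.inj hx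
    refine Eq.mpr (congrArg motive (comp_of_right_dim _ ?_)) (right y)
    exact ((inl A B).map_bd true 0 (suspObj _ true)).symm
  · exact comp x y _ hy

/-- Serves to show that `tgt` is the only sink: a cell from any other sink to it would be a
nonidentity cell out of that sink. -/
theorem exists_to_tgt : ∀ (T : Tree) (v : T.real.cat.Cell), T.real.cat.bd false 0 v = v →
    ∃ w, T.real.cat.bd false 0 w = v ∧ T.real.cat.bd true 0 w = T.real.tgt
  | .nil, _, _ => ⟨PUnit.unit, rfl, rfl⟩
  | .cons A B, ⟨(x, y), h⟩, hv => by
    have hy : B.real.cat.bd false 0 y = y := congrArg (fun z => z.1.2) hv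
    have hx : A.real.cat.susp.bd false 0 x = x := congrArg (fun z => z.1.1) hv
    rcases x with (_ | _) | x
    · obtain rfl : y = B.real.src := by
        rcases (h : InWedge _ _ _ _ _ _) with h | h | h
        · exact h
        · cases h
        · cases h.1
      obtain ⟨w, hw, hw'⟩ := B.exists_to_tgt _ hy
      -- The suspension of an object of the first branch is a `1`-cell from the first object to the
      -- second.
      exact ⟨⟨(suspCell A.real.src, w), Or.inr (Or.inr ⟨rfl, hw⟩)⟩,
        Subtype.ext (Prod.ext rfl hw), Subtype.ext (Prod.ext rfl hw')⟩
    · obtain ⟨w, hw, hw'⟩ := B.exists_to_tgt _ hy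
      exact ⟨(inr A B).toFun w, Subtype.ext (Prod.ext rfl hw), Subtype.ext (Prod.ext rfl hw')⟩
    · cases hx

theorem exists_from_src : ∀ (T : Tree) (v : T.real.cat.Cell), T.real.cat.bd false 0 v = v →
    ∃ w, T.real.cat.bd false 0 w = T.real.src ∧ T.real.cat.bd true 0 w = v
  | .nil, _, _ => ⟨PUnit.unit, rfl, rfl⟩
  | .cons A B, ⟨(x, y), h⟩, hv => by
    have hy : B.real.cat.bd false 0 y = y := congrArg (fun z => z.1.2) hv
    have hx : A.real.cat.susp.bd false 0 x = x := congrArg (fun z => z.1.1) hv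
    rcases x with (_ | _) | x
    · obtain rfl : y = B.real.src := by
        rcases (h : InWedge _ _ _ _ _ _) with h | h | h
        · exact h
        · cases h
        · cases h.1
      exact ⟨(cons A B).real.src, (cons A B).real.isSource.bd _ _,
        (cons A B).real.isSource.bd _ _⟩
    · obtain ⟨w, hw, hw'⟩ := B.exists_from_src _ hy
      exact ⟨⟨(suspCell A.real.src, w), Or.inr (Or.inr ⟨rfl, hw⟩)⟩,
        Subtype.ext (Prod.ext rfl hw), Subtype.ext (Prod.ext rfl hw')⟩
    · cases hx

theorem eq_tgt_of_isSink (T : Tree) {a : T.real.cat.Cell} (ha : T.real.cat.IsSink a) :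
    a = T.real.tgt := by
  obtain ⟨w, hw, hw'⟩ := T.exists_to_tgt a ha.1
  rw [← hw', ha.2 w hw, ha.bd]

theorem eq_src_of_isSource (T : Tree) {a : T.real.cat.Cell} (ha : T.real.cat.IsSource a) :
    a = T.real.src := by
  obtain ⟨w, hw, hw'⟩ := T.exists_from_src a (ha.bd _ _)
  rw [← hw, ha.2 w hw', ha.bd]

/-- Joining two trees at their roots. -/
def append : Tree → Tree → Tree
  | .nil, C => C
  | .cons A B, C => .cons A (append B C)

/-- Pushout squares are pasted along the list of branches. Preservation of `src` by `f` is carried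
through the induction because the next branch is attached there. -/
theorem isPushout_append : ∀ T C : Tree, ∃ (f : T.real.cat ⟶ (append T C).real.cat)
    (g : C.real.cat ⟶ (append T C).real.cat),
    f.toFun T.real.src = (append T C).real.src ∧
    IsPushout (const unit.{u} T.real.tgt (T.real.isSink.bd _ _))
      (const unit C.real.src (C.real.isSource.bd _ _)) f g
  | .nil, C => by
    refine ⟨const unit C.real.src (C.real.isSource.bd _ _), 𝟙 _, rfl, ?_⟩
    have : const unit.{u} nil.real.tgt (nil.real.isSink.bd _ _) = 𝟙 unit := hom_ext fun _ => rfl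
    rw [this]
    exact IsPushout.of_id_fst
  | .cons A B, C => by
    obtain ⟨f, g, hf, h⟩ := isPushout_append B C
    have hc : (inl.{u} A (append B C)).toFun (suspObj _ true) =
        (f ≫ inr A (append B C)).toFun B.real.src := by
      rw [inl_true, toFun_comp, hf]
    refine ⟨desc (inl A (append B C)) (f ≫ inr A (append B C)) hc, g ≫ inr A (append B C),
      desc_inl .., ?_⟩
    have h1 : const unit.{u} B.real.src (B.real.isSource.bd _ _) ≫ f =
        const unit (append B C).real.src ((append B C).real.isSource.bd _ _) :=
      hom_ext fun _ => hf
    have h2 : IsPushout f (inr A B) (inr A (append B C))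
        (desc (inl A (append B C)) (f ≫ inr A (append B C)) hc) := by
      refine IsPushout.of_left ?_ (inr_desc ..).symm (isPushout A B).flip
      rw [h1, inl_desc]
      exact (isPushout A (append B C)).flip
    exact (h.flip.paste_vert h2).flip

end Tree
end Tree
end StrictOmegaCat

namespace StrictOmegaCat

namespace Tree

/-- Every object of `Θ` is given by a tree. -/
theorem exists_iso_of_isTheta {C : StrictOmegaCat.{u}} (hC : C.IsTheta) :
    ∃ T : Tree, Nonempty (C ≅ T.real.cat) := by
  induction hC with
  | point T hT => exact ⟨.nil, ⟨hT.some.uniqueUpToIso isTerminalUnit⟩⟩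
  | susp A C hA e ih =>
    obtain ⟨T, ⟨e'⟩⟩ := ih
    -- A suspension is a tree with one branch: wedging with the point is pushing out along an
    -- isomorphism.
    have : IsIso (const unit.{u} nil.real.src (nil.real.isSource.bd _ _)) :=
      ⟨𝟙 _, hom_ext fun _ => rfl, hom_ext fun _ => rfl⟩
    have := (isPushout.{u} T nil).isIso_inl_of_isIso
    exact ⟨cons T nil, ⟨e.some ≪≫ suspIso e' ≪≫ asIso (inl T nil)⟩⟩
  | wedge T A B C hT hA hB a b ha hb f g hC ihA ihB =>
    obtain ⟨S, ⟨eA⟩⟩ := ihA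
    obtain ⟨R, ⟨eB⟩⟩ := ihB
    obtain ⟨f', g', -, h⟩ := isPushout_append S R
    let eT : T ≅ unit := hT.some.uniqueUpToIso isTerminalUnit
    have transport : ∀ {X Y : StrictOmegaCat.{u}} (e : X ≅ Y) (x : X.Cell) (z : Y.Cell),
        e.inv.toFun z = x ↔ z = e.hom.toFun x := by
      intro X Y e x z
      have h1 : ∀ z, e.hom.toFun (e.inv.toFun z) = z :=
        fun z => congrFun (congrArg Hom.toFun e.inv_hom_id) z
      have h2 : ∀ z, e.inv.toFun (e.hom.toFun z) = z :=
        fun z => congrFun (congrArg Hom.toFun e.hom_inv_id) z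
      constructor
      · rintro rfl
        exact (h1 z).symm
      · rintro rfl
        exact h2 x
    -- A tree has a unique sink and a unique source, so the gluing can only take place at the ends.
    have ea : ∀ t, eA.hom.toFun (a.toFun t) = S.real.tgt := by
      intro t
      refine S.eq_tgt_of_isSink ⟨?_, fun x hx => ?_⟩
      · rw [← Hom.map_bd, (ha t).1]
      · rw [← transport] at hx ⊢
        exact (ha t).2 _ (by rw [← Hom.map_bd, hx])
    have eb : ∀ t, eB.hom.toFun (b.toFun t) = R.real.src := by
      intro t
      refine R.eq_src_of_isSource ⟨?_, fun x hx => ?_⟩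
      · rw [← Hom.map_bd, (hb t).1]
      · rw [← transport] at hx ⊢
        exact (hb t).2 _ (by rw [← Hom.map_bd, hx])
    have ha' : const unit S.real.tgt (S.real.isSink.bd _ _) = (eT.inv ≫ a) ≫ eA.hom :=
      hom_ext fun t => (ea _).symm
    have hb' : const unit R.real.src (R.real.isSource.bd _ _) = (eT.inv ≫ b) ≫ eB.hom :=
      hom_ext fun t => (eb _).symm
    have h' : IsPushout a b (eA.hom ≫ f') (eB.hom ≫ g') :=
      h.of_iso eT.symm eA.symm eB.symm (Iso.refl _) ((Iso.comp_inv_eq _).2 ha')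
        ((Iso.comp_inv_eq _).2 hb') (by simp) (by simp)
    exact ⟨append S R, ⟨hC.isoIsPushout _ _ h'⟩⟩

/-! ### Degenerate maps out of trees. -/

variable {D : StrictOmegaCat.{u}}

/-- `F` factors through a noninvertible split epimorphism between trees, with a section that
preserves the source up to a `1`-cell which is collapsed. -/
def Degenerates (T : Tree) (F : T.real.cat ⟶ D) : Prop :=
  ∃ (T' : Tree) (p : T.real.cat ⟶ T'.real.cat) (s : T'.real.cat ⟶ T.real.cat)
    (G : T'.real.cat ⟶ D) (w : T.real.cat.Cell),
    s ≫ p = 𝟙 _ ∧ p ≫ G = F ∧ ¬ Function.Injective p.toFun ∧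
    p.toFun T.real.src = T'.real.src ∧ T.real.cat.bd false 0 w = T.real.src ∧
    T.real.cat.bd true 0 w = s.toFun T'.real.src ∧ T.real.cat.bd false 1 w = w ∧
    p.toFun w = T'.real.src

/-- A map which identifies the first two objects of a tree degenerates. -/
theorem degenerates_of_eq (hD : D.IsLoopFree) {A B : Tree} {F : (cons A B).real.cat ⟶ D}
    (h : (inl A B ≫ F).toFun (suspObj _ false) = (inl A B ≫ F).toFun (suspObj _ true)) :
    Degenerates (cons A B) F := by
  have hFr : (inl A B ≫ F).toFun (suspObj _ true) = (inr A B ≫ F).toFun B.real.src := rfl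
  -- Every cell of the first branch has image with equal `0`-source and `0`-target, hence an
  -- identity by loop-freeness.
  have hc (x) : (inl A B ≫ F).toFun x = (inr A B ≫ F).toFun B.real.src := by
    have h0 (ε) : D.bd ε 0 ((inl A B ≫ F).toFun x) = (inr A B ≫ F).toFun B.real.src := by
      rw [← Hom.map_bd]
      rcases x with (_ | _) | x
      · exact h
      · exact hFr
      · cases ε
        exacts [h, hFr]
    rw [← hD.eq_of_bd_eq ((h0 true).trans (h0 false).symm), h0]
  have hb : (const A.real.cat.susp B.real.src (B.real.isSource.bd _ _)).toFun (suspObj _ true) =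
    (𝟙 B.real.cat : B.real.cat ⟶ B.real.cat).toFun B.real.src := rfl
  -- The section starts at the second object; the collapsed `1`-cell `w` joins the first object to
  -- it.
  refine ⟨B, desc (const _ B.real.src (B.real.isSource.bd _ _)) (𝟙 _) hb, inr A B,
    inr A B ≫ F, (inl A B).toFun (suspCell A.real.src), inr_desc .., ?_, ?_, ?_, ?_, ?_, ?_, ?_⟩
  · refine real_hom_ext ?_ ?_
    · rw [← Category.assoc, inl_desc]
      exact hom_ext fun x => (hc x).symm
    · rw [← Category.assoc, inr_desc, Category.id_comp]
  · intro hinj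
    have := hinj (a₁ := (inl A B).toFun (suspObj _ false)) (a₂ := (inl A B).toFun (suspObj _ true))
      (by rw [desc_inl, desc_inl]; rfl)
    cases inl_injective A B this
  · rw [src_cons, desc_inl]
    rfl
  · exact ((inl A B).map_bd false 0 (suspCell A.real.src)).symm
  · exact ((inl A B).map_bd true 0 (suspCell A.real.src)).symm
  · refine ((inl A B).map_bd false 1 (suspCell A.real.src)).symm.trans ?_
    exact congrArg (fun z => (inl A B).toFun (suspCell z)) (A.real.isSource.bd false 0)
  · rw [desc_inl]
    rfl

/-- A map degenerates if its restriction to the suspension of the first branch does. -/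
theorem Degenerates.left {A B : Tree} {F : (cons A B).real.cat ⟶ D}
    (h : Degenerates A (suspRestrict (inl A B ≫ F))) : Degenerates (cons A B) F := by
  -- The data on sources can be dropped: suspended maps fix both objects, so the new section
  -- preserves the source and the new `w` is an identity.
  obtain ⟨T, p, s, G, w, hsp, hpG, hinj, -, -, -, -, -⟩ := h
  have hp : D.bd false 0 ((inl A B ≫ F).toFun (suspObj _ false)) = (inl A B ≫ F).toFun (suspObj _ false) :=
    ((inl A B ≫ F).map_bd false 0 (suspObj _ false)).symm
  have hq : D.bd false 0 ((inl A B ≫ F).toFun (suspObj _ true)) = (inl A B ≫ F).toFun (suspObj _ true) :=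
    ((inl A B ≫ F).map_bd false 0 (suspObj _ true)).symm
  have hlift : suspMap p ≫ suspLift hp hq G = inl A B ≫ F := by
    refine hom_ext fun x => ?_
    rcases x with (_ | _) | x
    · rfl
    · rfl
    · exact congrArg Subtype.val (congrFun (congrArg Hom.toFun hpG) x)
  have hsp' : suspMap s ≫ suspMap p = 𝟙 _ :=
    susp_hom_ext (fun _ => rfl) fun x =>
      congrArg Sum.inr (congrFun (congrArg Hom.toFun hsp) x)
  have e1 : (suspMap p ≫ inl T B).toFun (suspObj _ true) = (inr T B).toFun B.real.src := rfl
  have e2 : (suspMap s ≫ inl A B).toFun (suspObj _ true) = (inr A B).toFun B.real.src := rfl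
  have e3 : (suspLift hp hq G).toFun (suspObj _ true) = (inr A B ≫ F).toFun B.real.src := rfl
  refine ⟨cons T B, desc (suspMap p ≫ inl T B) (inr T B) e1,
    desc (suspMap s ≫ inl A B) (inr A B) e2, desc (suspLift hp hq G) (inr A B ≫ F) e3,
    (cons A B).real.src, ?_, ?_, ?_, ?_, ?_, ?_, ?_, ?_⟩
  · refine real_hom_ext ?_ ?_
    · rw [← Category.assoc, inl_desc, Category.assoc, inl_desc, ← Category.assoc, hsp',
        Category.id_comp, Category.comp_id]
    · rw [← Category.assoc, inr_desc, inr_desc, Category.comp_id]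
  · refine real_hom_ext ?_ ?_
    · rw [← Category.assoc, inl_desc, Category.assoc, inl_desc, hlift]
    · rw [← Category.assoc, inr_desc, inr_desc]
  · intro hi
    refine hinj fun x y hxy => ?_
    have := hi (a₁ := (inl A B).toFun (suspCell x)) (a₂ := (inl A B).toFun (suspCell y)) (by
      rw [desc_inl, desc_inl]
      exact congrArg (fun z => (inl T B).toFun (suspCell z)) hxy)
    exact Sum.inr.inj (inl_injective A B this)
  · rw [src_cons, desc_inl]
    rfl
  · exact (cons A B).real.isSource.bd _ _
  · rw [(cons A B).real.isSource.bd, src_cons (A := T), desc_inl]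
    rfl
  · exact (cons A B).real.isSource.bd _ _
  · rw [src_cons, desc_inl]
    rfl

/-- A map degenerates if its restriction to the branches other than the first one does. -/
theorem Degenerates.right {A B : Tree} {F : (cons A B).real.cat ⟶ D}
    (h : Degenerates B (inr A B ≫ F)) : Degenerates (cons A B) F := by
  obtain ⟨T, p, s, G, w, hsp, hpG, hinj, hsrc, h0, h1, hw, hpw⟩ := h
  have g0 : (cons A B).real.cat.bd false 0 ((inr A B).toFun w) = (inl A B).toFun (suspObj _ true) := by
    rw [← Hom.map_bd, h0]
    rfl
  have g1 : (cons A B).real.cat.bd true 0 ((inr A B).toFun w) =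
      (inr A B).toFun (s.toFun T.real.src) := by
    rw [← Hom.map_bd, h1]
  have gw : (cons A B).real.cat.bd false 1 ((inr A B).toFun w) = (inr A B).toFun w := by
    rw [← Hom.map_bd, hw]
  have hp : (cons A B).real.cat.bd false 0 ((inl A B).toFun (suspObj _ false)) =
      (inl A B).toFun (suspObj _ false) := ((inl A B).map_bd false 0 (suspObj _ false)).symm
  have hq : (cons A B).real.cat.bd false 0 ((inr A B).toFun (s.toFun T.real.src)) =
      (inr A B).toFun (s.toFun T.real.src) := by
    rw [← Hom.map_bd, ← Hom.map_bd, T.real.isSource.bd]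
  have hG : (inl A B ≫ F).toFun (suspObj _ true) = G.toFun T.real.src := by
    rw [← hsrc]
    exact (congrFun (congrArg Hom.toFun hpG) B.real.src).symm
  have hpp : (inl A T).toFun (suspObj _ true) = (p ≫ inr A T).toFun B.real.src := by
    rw [toFun_comp, hsrc]
    rfl
  have hps (y) : p.toFun (s.toFun y) = y := congrFun (congrArg Hom.toFun hsp) y
  -- The section `s` may move the source of `B`, so the first branch is prolonged by `w` to reach
  -- its new starting point. Since `p` collapses `w`, this is still a section.
  have hs : (suspLift hp hq (suspRestrict (inl A B) ≫ postcomp _ g0 g1 gw)).toFun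
    (suspObj _ true) = (s ≫ inr A B).toFun T.real.src := rfl
  refine ⟨cons A T, desc (inl A T) (p ≫ inr A T) hpp,
    desc (suspLift hp hq (suspRestrict (inl A B) ≫ postcomp _ g0 g1 gw)) (s ≫ inr A B) hs,
    desc (inl A B ≫ F) G hG, (cons A B).real.src, ?_, ?_, ?_, ?_, ?_, ?_, ?_, ?_⟩
  · refine real_hom_ext ?_ ?_
    · rw [← Category.assoc, inl_desc, Category.comp_id]
      refine hom_ext fun x => ?_
      rw [toFun_comp]
      rcases x with (_ | _) | x
      · exact desc_inl ..
      · refine (desc_inr ..).trans ?_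
        rw [toFun_comp, hps]
        rfl
      · refine (map_comp' _ (((suspRestrict (inl A B)).toFun x).2.2.trans g0.symm)).trans ?_
        refine (comp_of_left_dim _ ?_).trans (desc_inl ..)
        rw [desc_inr, toFun_comp, hpw, ← Hom.map_bd, T.real.isSource.bd]
    · rw [← Category.assoc, inr_desc, Category.assoc, inr_desc, ← Category.assoc, hsp,
        Category.id_comp, Category.comp_id]
  · refine real_hom_ext ?_ ?_
    · rw [← Category.assoc, inl_desc, inl_desc]
    · rw [← Category.assoc, inr_desc, Category.assoc, inr_desc, hpG]
  · intro hi
    refine hinj fun x y hxy => ?_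
    have := hi (a₁ := (inr A B).toFun x) (a₂ := (inr A B).toFun y) (by
      rw [desc_inr, desc_inr, toFun_comp, toFun_comp, hxy])
    exact inr_injective A B this
  · rw [src_cons, desc_inl]
    rfl
  · exact (cons A B).real.isSource.bd _ _
  · rw [(cons A B).real.isSource.bd, src_cons (A := A) (B := T), desc_inl]
    rfl
  · exact (cons A B).real.isSource.bd _ _
  · rw [src_cons, desc_inl]
    rfl

/-! ### Injectivity on a tree from injectivity on its branches. -/

/-- The values of a map at an object of the remaining branches and at the first object of a tree
differ, unless the first two objects are identified. -/
theorem map_inr_ne (hD : D.IsLoopFree) {A B : Tree} (F : (cons A B).real.cat ⟶ D)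
    (h : F.toFun ((inl A B).toFun (suspObj _ false)) ≠ F.toFun ((inl A B).toFun (suspObj _ true)))
    (v : B.real.cat.Cell) (hv : B.real.cat.bd false 0 v = v) :
    F.toFun ((inr A B).toFun v) ≠ F.toFun ((inl A B).toFun (suspObj _ false)) := by
  intro he
  obtain ⟨w, hw, hw'⟩ := B.exists_from_src v hv
  let x : A.real.cat.susp.Cell := suspCell A.real.src
  have h1 : D.bd false 0 (F.toFun ((inl A B).toFun x)) = F.toFun ((inl A B).toFun (suspObj _ false)) := by
    rw [← Hom.map_bd, ← Hom.map_bd]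
    rfl
  have h2 : D.bd true 0 (F.toFun ((inl A B).toFun x)) = F.toFun ((inl A B).toFun (suspObj _ true)) := by
    rw [← Hom.map_bd, ← Hom.map_bd]
    rfl
  have h3 : D.bd false 0 (F.toFun ((inr A B).toFun w)) =
      F.toFun ((inl A B).toFun (suspObj _ true)) := by
    rw [← Hom.map_bd, ← Hom.map_bd, hw]
    rfl
  have h4 : D.bd true 0 (F.toFun ((inr A B).toFun w)) = F.toFun ((inr A B).toFun v) := by
    rw [← Hom.map_bd, ← Hom.map_bd, hw']
  -- The images of a `1`-cell to the second object and of a cell from there to `v` would form a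
  -- directed cycle.
  have h5 := hD 0 _ _ (h2.trans h3.symm) (h4.trans (he.trans h1.symm))
  refine h (h1.symm.trans (Eq.trans ?_ h2))
  rw [← h5, D.bd_bd_of_le _ _ _ _ _ le_rfl, D.bd_bd_of_le _ _ _ _ _ le_rfl]

/-- A map is injective as soon as its restrictions to the suspension of the first branch and to
the other branches are. -/
theorem injective_cons (hD : D.IsLoopFree) (hD' : D.IsHypercancellative) {A B : Tree}
    {F : (cons A B).real.cat ⟶ D}
    (h : F.toFun ((inl A B).toFun (suspObj _ false)) ≠ F.toFun ((inl A B).toFun (suspObj _ true)))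
    (hl : Function.Injective (suspRestrict (inl A B ≫ F)).toFun)
    (hr : Function.Injective (inr A B ≫ F).toFun) : Function.Injective F.toFun := by
  have hobj := map_inr_ne hD F h
  have hl' (x y : A.real.cat.Cell) (he : F.toFun ((inl A B).toFun (suspCell x)) =
      F.toFun ((inl A B).toFun (suspCell y))) : x = y := hl (Subtype.ext he)
  have hr' (x y : B.real.cat.Cell) (he : F.toFun ((inr A B).toFun x) =
      F.toFun ((inr A B).toFun y)) : x = y := hr he
  have hobj' (ε : Bool) (y : B.real.cat.Cell) : D.bd ε 0 (F.toFun ((inr A B).toFun y)) ≠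
      F.toFun ((inl A B).toFun (suspObj _ false)) := by
    rw [← Hom.map_bd, ← Hom.map_bd]
    exact hobj _ (B.real.cat.bd_bd_of_le _ _ _ _ _ le_rfl)
  have hs (ε : Bool) : D.bd ε 0 (F.toFun ((inl A B).toFun (suspObj _ false))) =
      F.toFun ((inl A B).toFun (suspObj _ false)) := by
    rw [← Hom.map_bd, ← Hom.map_bd]
    rfl
  have hx (x : A.real.cat.Cell) : D.bd false 0 (F.toFun ((inl A B).toFun (suspCell x))) =
      F.toFun ((inl A B).toFun (suspObj _ false)) := by
    rw [← Hom.map_bd, ← Hom.map_bd]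
    rfl
  have hx' (x : A.real.cat.Cell) : D.bd true 0 (F.toFun ((inl A B).toFun (suspCell x))) =
      F.toFun ((inr A B).toFun B.real.src) := by
    rw [← Hom.map_bd, ← Hom.map_bd]
    rfl
  have hb : B.real.cat.bd false 0 B.real.src = B.real.src := B.real.isSource.bd _ _
  let W := (cons A B).real.cat
  have hcomp (x y) (hy : B.real.cat.bd false 0 y = B.real.src) :
      W.bd true 0 ((inl A B).toFun (suspCell x)) = W.bd false 0 ((inr A B).toFun y) := by
    rw [← Hom.map_bd, ← Hom.map_bd, hy]
    rfl
  have hcases (z : (cons A B).real.cat.Cell) : z = (inl A B).toFun (suspObj _ false) ∨ (∃ y, z = (inr A B).toFun y) ∨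
      ∃ x y, ∃ hy : B.real.cat.bd false 0 y = B.real.src,
        z = W.comp 0 ((inr A B).toFun y) ((inl A B).toFun (suspCell x)) (hcomp x y hy) := by
    induction z using real_cases with
    | left x =>
      rcases x with (_ | _) | x
      · exact Or.inl rfl
      · exact Or.inr (Or.inl ⟨B.real.src, rfl⟩)
      · refine Or.inr (Or.inr ⟨x, B.real.src, hb, (comp_of_left_dim _ ?_).symm⟩)
        rw [← Hom.map_bd, hb]
    | right y => exact Or.inr (Or.inl ⟨y, rfl⟩)
    | comp x y _ hy => exact Or.inr (Or.inr ⟨x, y, hy, rfl⟩)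
  intro z z' he
  have he' (ε : Bool) := congrArg (D.bd ε 0) he
  have hcs (x y hy) : D.bd false 0 (F.toFun (W.comp 0 ((inr A B).toFun y)
      ((inl A B).toFun (suspCell x)) (hcomp x y hy))) =
      F.toFun ((inl A B).toFun (suspObj _ false)) := by
    rw [map_comp', D.bd_false_comp, hx]
  have hct (x y hy) : D.bd true 0 (F.toFun (W.comp 0 ((inr A B).toFun y)
      ((inl A B).toFun (suspCell x)) (hcomp x y hy))) =
      D.bd true 0 (F.toFun ((inr A B).toFun y)) := by
    rw [map_comp', D.bd_true_comp]
  -- The image of the first object is both `0`-boundaries of itself, only the `0`-source for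
  -- composites, and neither `0`-boundary for cells of `B`. Mixed cases are thereby excluded.
  rcases hcases z with rfl | ⟨y, rfl⟩ | ⟨x, y, hy, rfl⟩ <;>
    rcases hcases z' with rfl | ⟨y', rfl⟩ | ⟨x', y', hy', rfl⟩
  · rfl
  · exact absurd ((he' true).symm.trans (hs true)) (hobj' _ _)
  · exact absurd (((he' true).trans (hct _ _ hy')).symm.trans (hs true)) (hobj' _ _)
  · exact absurd ((he' true).trans (hs true)) (hobj' _ _)
  · rw [hr' y y' he]
  · exact absurd ((he' false).trans (hcs _ _ hy')) (hobj' _ _)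
  · exact absurd ((hct _ _ hy).symm.trans ((he' true).trans (hs true))) (hobj' _ _)
  · exact absurd ((he' false).symm.trans (hcs _ _ hy)) (hobj' _ _)
  · rw [map_comp', map_comp'] at he
    obtain ⟨h1, h2⟩ := hD' 0 _ _ _ _ _ _ ((hx' x).trans (hx' x').symm) he
    obtain rfl := hl' _ _ h1
    obtain rfl := hr' _ _ h2
    rfl

/-- Structural induction with `D` varying, since the first branch maps to a hom ω-category of `D`.
-/
theorem injective_or_degenerates : ∀ (T : Tree) {D : StrictOmegaCat.{u}} (_ : D.IsLoopFree)
    (_ : D.IsHypercancellative) (F : T.real.cat ⟶ D),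
    Function.Injective F.toFun ∨ Degenerates T F
  | .nil, _, _, _, _ => Or.inl fun _ _ _ => rfl
  | .cons A B, D, hD, hD', F => by
    by_cases h : F.toFun ((inl A B).toFun (suspObj _ false)) = F.toFun ((inl A B).toFun (suspObj _ true))
    · exact Or.inr (degenerates_of_eq hD h)
    · rcases A.injective_or_degenerates (hD.homCat _ _) (hD'.homCat _ _)
        (suspRestrict (inl A B ≫ F)) with hA | hA
      · rcases B.injective_or_degenerates hD hD' (inr A B ≫ F) with hB | hB
        · exact Or.inl (injective_cons hD hD' h hA hB)
        · exact Or.inr hB.right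
      · exact Or.inr hA.left

end Tree

/-- A strict ω-category which is hypercancellative and has no directed cycles is `Θ`-regular. -/
theorem IsLoopFree.isThetaRegular {D : StrictOmegaCat.{u}} (hD : D.IsLoopFree)
    (hD' : D.IsHypercancellative) : D.IsThetaRegular := by
  intro θ F hθ hF
  obtain ⟨T, ⟨e⟩⟩ := Tree.exists_iso_of_isTheta hθ
  rcases T.injective_or_degenerates hD hD' (e.inv ≫ F) with h | ⟨T', p, s, G, -, h1, h2, h3, -⟩
  · have : Mono (e.inv ≫ F) :=
      ⟨fun g g' hg => hom_ext fun x => h (congrFun (congrArg Hom.toFun hg) x)⟩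
    rw [← e.hom_inv_id_assoc F]
    exact mono_comp _ _
  -- Nondegeneracy would make the split epimorphism `p` invertible, hence injective, against `h3`.
  · have hep : IsIso (e.hom ≫ p) := hF _ (e.hom ≫ p) G T'.isTheta
      ⟨⟨s ≫ e.inv, by simp [h1]⟩⟩ (by rw [Category.assoc, h2, e.hom_inv_id_assoc])
    have : IsIso p := IsIso.of_isIso_comp_left e.hom p
    refine absurd (fun x y hxy => ?_) h3
    have hinv (x) : (inv p).toFun (p.toFun x) = x :=
      congrFun (congrArg Hom.toFun (IsIso.hom_inv_id p)) x
    rw [← hinv x, hxy, hinv]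

end StrictOmegaCat

theorem proposition2p6 (P : OmegaHypergraph.{u}) (hP : P.IsTorsionFree) :
    ∃ h : P.CompClosed, (P.cells h).IsThetaRegular ∧ (P.cells h).IsHypercancellative :=
  ⟨hP.compClosed, hP.isLoopFree.isThetaRegular hP.isHypercancellative, hP.isHypercancellative⟩
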